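/- Let $0<l<u<\infty$, $L>0$, $\tau>0$ and $\alpha\in\mathbb R$. For each $n$ let $\epsilon_{1,n},\dots,\epsilon_{n,n}$ be i.i.d. $\mathcal N(0,1)$ random variables, independent of a standard Brownian motion $W$. For $p=\lfloor\alpha\rfloor$ let $\mathcal C^b(\alpha,L)=\mathcal C^b(\alpha,L,[l,u])$ be the class of all functions $f$ on $[0,1]$ such that $f^{(p)}$ exists on $[0,1]$, $|f^{(p)}(x)-f^{(p)}(y)|\le L|x-y|^{\alpha-p}$ for all $x,y\in[0,1]$, and $l\le f\le u$. Let $\sigma>0$ be an unknown deterministic function on $[0,1]$ with $\sigma^2\in\mathcal C^b(\alpha,L)$. Assume that (a) $\alpha>1/2$ and one observes $Y_{i,n}=\int_0^{i/n}\sigma(s)\,dW_s+\tau\epsilon_{i,n}$, $i=1,\dots,n$; or (b) $\alpha\ge 1$ and one observes $\tilde Y_{i,n}=\sigma(i/n)\,W_{i/n}+\tau\epsilon_{i,n}$, $i=1,\dots,n$. Then there is a constant $C>0$, depending only on $\alpha,L,l,u$ and the known noise level $\tau$, such that $$\liminf_{n\to\infty}\ \inf_{\hat\sigma_n^2}\ \sup_{\sigma^2\in\mathcal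 C^b(\alpha,L)}\ \mathrm E\Big(n^{\frac{\alpha}{2\alpha+1}}\,\big\|\hat\sigma_n^2-\sigma^2\big\|_2^2\Big)\ \ge\ C ,$$ where $\|g\|_2^2=\int_0^1 g(t)^2\,dt$ and the infimum is over all estimators $\hat\sigma_n^2$, i.e. all (jointly measurable) functions of the $n$ observations with values in the functions on $[0,1]$. (Thus the rate of convergence in $L_2$-norm is no better than $n^{-\alpha/(4\alpha+2)}$.) -/

import Mathlib

open MeasureTheory ProbabilityTheory Filter Set Topology
open scoped NNReal ENNReal

namespace VolatilityModel

noncomputable section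

/-! ### Wiener integrals of deterministic integrands -/

/-- A real step function `∑ k, coef k • 1_{(left k, right k]}` on `[0, ∞)`. -/
structure StepFun where
  size : ℕ
  coef : Fin size → ℝ
  left : Fin size → ℝ≥0
  right : Fin size → ℝ≥0
  le : ∀ k, left k ≤ right k

/-- The step function as a function on the time axis. -/
def StepFun.eval (S : StepFun) (s : ℝ) : ℝ :=
  ∑ k, S.coef k * (Ioc (S.left k : ℝ) (S.right k)).indicator (fun _ ↦ (1 : ℝ)) s

/-- The integral `∑ k, coef k * (W (right k) - W (left k))` of a step function against `W`. -/
def StepFun.integral {Ω : Type*} (S : StepFun) (W : ℝ≥0 → Ω → ℝ) (ω : Ω) : ℝ :=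
  ∑ k, S.coef k * (W (S.right k) ω - W (S.left k) ω)

/-- `X` is (a version of) the Wiener integral `∫₀ᵗ g(s) dW_s`: it is the `L²(P)`-limit of the
integrals of step functions which converge to `g 1_{(0,t]}` in `L²(ds)`. -/
def IsWienerIntegral {Ω : Type*} [MeasurableSpace Ω] (W : ℝ≥0 → Ω → ℝ) (P : Measure Ω)
    (g : ℝ → ℝ) (t : ℝ≥0) (X : Ω → ℝ) : Prop :=
  MemLp X 2 P ∧ ∃ S : ℕ → StepFun,
    Tendsto (fun m ↦ eLpNorm (fun s ↦ (S m).eval s - (Ioc (0 : ℝ) t).indicator g s) 2 volume)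
      atTop (𝓝 0) ∧
    Tendsto (fun m ↦ eLpNorm (fun ω ↦ (S m).integral W ω - X ω) 2 P) atTop (𝓝 0)

open Classical in
/-- The Wiener integral `∫₀ᵗ g(s) dW_s` as a random variable. For `W` a Brownian motion and `g`
continuous on `[0,t]` it exists and is unique up to almost sure equality, see
`isWienerIntegral_wienerIntegral` and `IsWienerIntegral.ae_eq`. -/
def wienerIntegral {Ω : Type*} [MeasurableSpace Ω] (W : ℝ≥0 → Ω → ℝ) (P : Measure Ω)
    (g : ℝ → ℝ) (t : ℝ≥0) : Ω → ℝ :=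
  if h : ∃ X, IsWienerIntegral W P g t X then h.choose else 0

section Wellposed

variable {Ω : Type*} [MeasurableSpace Ω] {P : Measure Ω} {W : ℝ≥0 → Ω → ℝ}

theorem integral_sq_sum_increments (hW : IsPreBrownianReal W P) {ι : Type*} [Fintype ι]
    (c : ι → ℝ) (a b : ι → ℝ≥0) (hab : ∀ i, a i ≤ b i) :
    ∫ ω, (∑ i, c i * (W (b i) ω - W (a i) ω)) ^ 2 ∂P =
      ∫ s, (∑ i, c i * (Ioc (a i : ℝ) (b i)).indicator (fun _ ↦ (1 : ℝ)) s) ^ 2 := by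
  have hP : IsProbabilityMeasure P := hW.isGaussianProcess.isProbabilityMeasure
  have hm : ∀ t, MemLp (W t) 2 P := fun t ↦
    (hW.isGaussianProcess.hasGaussianLaw_eval t).memLp_two
  have hmul : ∀ s t, Integrable (fun ω ↦ W s ω * W t ω) P := fun s t ↦ (hm s).integrable_mul (hm t)
  have hcov : ∀ s t, ∫ ω, W s ω * W t ω ∂P = min (s : ℝ) t := fun s t ↦ by
    have h := hW.covariance_eval s t
    rw [covariance_eq_sub (hm s) (hm t), hW.integral_eval, hW.integral_eval] at h
    simpa using h
  have hD : ∀ i, MemLp (fun ω ↦ W (b i) ω - W (a i) ω) 2 P := fun i ↦ (hm _).sub (hm _)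
  have hI : ∀ i : ι, MemLp ((Ioc (a i : ℝ) (b i)).indicator (fun _ ↦ (1 : ℝ))) 2 volume :=
    fun i ↦ memLp_indicator_const 2 measurableSet_Ioc 1 (Or.inr (by simp))
  have hkey : ∀ i j, ∫ ω, (W (b i) ω - W (a i) ω) * (W (b j) ω - W (a j) ω) ∂P =
      ∫ s, (Ioc (a i : ℝ) (b i)).indicator (fun _ ↦ (1 : ℝ)) s *
        (Ioc (a j : ℝ) (b j)).indicator (fun _ ↦ (1 : ℝ)) s := fun i j ↦ by
    have e1 : ∀ ω, (W (b i) ω - W (a i) ω) * (W (b j) ω - W (a j) ω) =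
        (W (b i) ω * W (b j) ω - W (b i) ω * W (a j) ω) -
        (W (a i) ω * W (b j) ω - W (a i) ω * W (a j) ω) := fun ω ↦ by ring
    have e2 : ∀ s, (Ioc (a i : ℝ) (b i)).indicator (fun _ ↦ (1 : ℝ)) s *
        (Ioc (a j : ℝ) (b j)).indicator (fun _ ↦ (1 : ℝ)) s =
        (Ioc (max (a i : ℝ) (a j)) (min (b i : ℝ) (b j))).indicator (fun _ ↦ (1 : ℝ)) s :=
      fun s ↦ by
        simp only [indicator_apply, mem_Ioc, max_lt_iff, le_min_iff]
        split_ifs <;> grind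
    have i1 : ∀ p q r : ℝ≥0, Integrable (fun ω ↦ W p ω * W q ω - W p ω * W r ω) P :=
      fun p q r ↦ (hmul p q).sub (hmul p r)
    simp_rw [e1, e2]
    rw [integral_sub (i1 _ _ _) (i1 _ _ _),
      integral_sub (hmul _ _) (hmul _ _), integral_sub (hmul _ _) (hmul _ _), hcov, hcov, hcov,
      hcov, integral_indicator_const _ measurableSet_Ioc, Real.volume_real_Ioc]
    have h1 : (a i : ℝ) ≤ b i := hab i
    have h2 : (a j : ℝ) ≤ b j := hab j
    simp only [smul_eq_mul, mul_one]
    grind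
  have i2 : ∀ i j, Integrable (fun ω ↦ c i * (W (b i) ω - W (a i) ω) *
      (c j * (W (b j) ω - W (a j) ω))) P := fun i j ↦
    ((hD i).const_mul (c i)).integrable_mul ((hD j).const_mul (c j))
  have i3 : ∀ i j, Integrable (fun s ↦ c i * (Ioc (a i : ℝ) (b i)).indicator (fun _ ↦ (1 : ℝ)) s *
      (c j * (Ioc (a j : ℝ) (b j)).indicator (fun _ ↦ (1 : ℝ)) s)) := fun i j ↦
    ((hI i).const_mul (c i)).integrable_mul ((hI j).const_mul (c j))
  simp_rw [sq, Finset.sum_mul_sum]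
  rw [integral_finsetSum _ (fun i _ ↦ integrable_finsetSum _ fun j _ ↦ i2 i j),
    integral_finsetSum _ (fun i _ ↦ integrable_finsetSum _ fun j _ ↦ i3 i j)]
  refine Finset.sum_congr rfl fun i _ ↦ ?_
  rw [integral_finsetSum _ (fun j _ ↦ i2 i j), integral_finsetSum _ (fun j _ ↦ i3 i j)]
  refine Finset.sum_congr rfl fun j _ ↦ ?_
  simp_rw [mul_mul_mul_comm (c i), integral_const_mul, hkey]

theorem StepFun.memLp_eval (S : StepFun) : MemLp S.eval 2 volume :=
  memLp_finsetSum _ fun k _ ↦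
    (memLp_indicator_const 2 measurableSet_Ioc 1 (Or.inr (by simp))).const_mul _

theorem StepFun.memLp_integral (hW : IsPreBrownianReal W P) (S : StepFun) :
    MemLp (S.integral W) 2 P := by
  have hm : ∀ t, MemLp (W t) 2 P := fun t ↦
    (hW.isGaussianProcess.hasGaussianLaw_eval t).memLp_two
  exact memLp_finsetSum _ fun k _ ↦ ((hm _).sub (hm _)).const_mul _

/-- The Itô isometry for differences of step functions. -/
theorem StepFun.isometry (hW : IsPreBrownianReal W P) (S T : StepFun) :
    eLpNorm (fun ω ↦ S.integral W ω - T.integral W ω) 2 P =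
      eLpNorm (fun s ↦ S.eval s - T.eval s) 2 volume := by
  have h := integral_sq_sum_increments hW (Sum.elim S.coef (fun k ↦ -T.coef k))
    (Sum.elim S.left T.left) (Sum.elim S.right T.right)
    (by rintro (k | k); exacts [S.le k, T.le k])
  simp only [Fintype.sum_sum_type, Sum.elim_inl, Sum.elim_inr, neg_mul, Finset.sum_neg_distrib,
    ← sub_eq_add_neg] at h
  have hST := (S.memLp_integral hW).sub (T.memLp_integral hW)
  have hST' := S.memLp_eval.sub T.memLp_eval
  rw [show (fun ω ↦ S.integral W ω - T.integral W ω) = S.integral W - T.integral W from rfl,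
    show (fun s ↦ S.eval s - T.eval s) = S.eval - T.eval from rfl,
    hST.eLpNorm_eq_integral_rpow_norm two_ne_zero ENNReal.ofNat_ne_top,
    hST'.eLpNorm_eq_integral_rpow_norm two_ne_zero ENNReal.ofNat_ne_top]
  simp only [ENNReal.toReal_ofNat, Real.rpow_ofNat, Real.norm_eq_abs, sq_abs, Pi.sub_apply]
  simp only [StepFun.integral, StepFun.eval]
  rw [h]

/-- Two versions of the Wiener integral agree almost surely. -/
theorem IsWienerIntegral.ae_eq (hW : IsPreBrownianReal W P) {g : ℝ → ℝ} {t : ℝ≥0} {X Y : Ω → ℝ}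
    (hg : AEStronglyMeasurable ((Ioc (0 : ℝ) t).indicator g) volume)
    (hX : IsWienerIntegral W P g t X) (hY : IsWienerIntegral W P g t Y) : X =ᵐ[P] Y := by
  obtain ⟨hXm, S, hS, hSX⟩ := hX
  obtain ⟨hYm, T, hT, hTY⟩ := hY
  set h := (Ioc (0 : ℝ) t).indicator g with hh
  have key : ∀ m, eLpNorm (X - Y) 2 P ≤
      eLpNorm (fun ω ↦ (S m).integral W ω - X ω) 2 P +
      (eLpNorm (fun s ↦ (S m).eval s - h s) 2 volume +
        eLpNorm (fun s ↦ (T m).eval s - h s) 2 volume) +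
      eLpNorm (fun ω ↦ (T m).integral W ω - Y ω) 2 P := fun m ↦ by
    have mS := ((S m).memLp_integral hW).aestronglyMeasurable
    have mT := ((T m).memLp_integral hW).aestronglyMeasurable
    have eS := (S m).memLp_eval.aestronglyMeasurable
    have eT := (T m).memLp_eval.aestronglyMeasurable
    have e : X - Y = (-((S m).integral W - X) + ((S m).integral W - (T m).integral W)) +
        ((T m).integral W - Y) := by abel
    have e' : (S m).eval - (T m).eval = ((S m).eval - h) + (-((T m).eval - h)) := by abel
    rw [e]
    refine (eLpNorm_add_le ((mS.sub hXm.aestronglyMeasurable).neg.add (mS.sub mT))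
      (mT.sub hYm.aestronglyMeasurable) one_le_two).trans ?_
    refine add_le_add ?_ le_rfl
    refine (eLpNorm_add_le (mS.sub hXm.aestronglyMeasurable).neg (mS.sub mT) one_le_two).trans ?_
    rw [eLpNorm_neg]
    refine add_le_add le_rfl ?_
    refine ((S m).isometry hW (T m)).le.trans ?_
    change eLpNorm ((S m).eval - (T m).eval) 2 volume ≤ _
    rw [e']
    refine (eLpNorm_add_le (eS.sub hg) (eT.sub hg).neg one_le_two).trans ?_
    rw [eLpNorm_neg]
    exact le_rfl
  have lim := (hSX.add (hS.add hT)).add hTY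
  simp only [add_zero] at lim
  have h0 : eLpNorm (X - Y) 2 P = 0 := le_antisymm (ge_of_tendsto' lim key) zero_le
  rw [eLpNorm_eq_zero_iff (hXm.sub hYm).aestronglyMeasurable two_ne_zero] at h0
  filter_upwards [h0] with ω hω
  simpa [sub_eq_zero] using hω

/-- The step function with `m` steps on `(0,t]` which interpolates `g` at the right endpoints. -/
def StepFun.riemann (g : ℝ → ℝ) (t : ℝ≥0) (m : ℕ) : StepFun where
  size := m
  coef k := g (t * ((k : ℝ) + 1) / m)
  left k := t * k / m
  right k := t * (k + 1) / m
  le k := by gcongr; simp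

theorem StepFun.riemann_eval_of_notMem (g : ℝ → ℝ) (t : ℝ≥0) (m : ℕ) {s : ℝ}
    (hs : s ∉ Ioc (0 : ℝ) t) : (StepFun.riemann g t m).eval s = 0 := by
  refine Finset.sum_eq_zero fun k _ ↦ ?_
  rw [indicator_of_notMem, mul_zero]
  refine fun h ↦ hs ⟨lt_of_le_of_lt (NNReal.coe_nonneg _) h.1, h.2.trans ?_⟩
  have hk : (k : ℕ) + 1 ≤ m := k.2
  have hk' : ((k : ℕ) : ℝ) + 1 ≤ m := by exact_mod_cast hk
  have hm : (0 : ℝ) < m := by linarith [(Nat.cast_nonneg (k : ℕ) : (0 : ℝ) ≤ _)]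
  simp only [StepFun.riemann, NNReal.coe_div, NNReal.coe_mul, NNReal.coe_add, NNReal.coe_natCast,
    NNReal.coe_one]
  rw [div_le_iff₀ hm]
  gcongr

theorem StepFun.riemann_eval_of_mem (g : ℝ → ℝ) (t : ℝ≥0) {m : ℕ} (hm : 0 < m) {s : ℝ}
    (hs : s ∈ Ioc (0 : ℝ) t) : ∃ r ∈ Icc (0 : ℝ) t, |r - s| ≤ t / m ∧
      (StepFun.riemann g t m).eval s = g r := by
  have ht : (0 : ℝ) < t := hs.1.trans_le hs.2
  have hm' : (0 : ℝ) < m := by exact_mod_cast hm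
  set q : ℕ := ⌈s * m / t⌉₊ with hq
  have hq0 : 0 < q := Nat.ceil_pos.2 (by have := hs.1; positivity)
  have hq1 : q ≤ m := Nat.ceil_le.2 (by
    rw [div_le_iff₀ ht, mul_comm]; exact mul_le_mul_of_nonneg_left hs.2 hm'.le)
  have hle : s * m / t ≤ q := Nat.le_ceil _
  have hlt : (q : ℝ) < s * m / t + 1 := Nat.ceil_lt_add_one (by have := hs.1; positivity)
  have hle' : s ≤ t * q / m := by
    rw [div_le_iff₀ ht] at hle
    rw [le_div_iff₀ hm']; linarith
  have hlt' : t * ((q : ℝ) - 1) / m < s := by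
    have : (q : ℝ) - 1 < s * m / t := by linarith
    rw [lt_div_iff₀ ht] at this
    rw [div_lt_iff₀ hm']; linarith
  refine ⟨t * q / m, ⟨by positivity, ?_⟩, ?_, ?_⟩
  · rw [div_le_iff₀ hm']
    gcongr
  · have : t * ((q : ℝ) - 1) / m = t * q / m - t / m := by ring
    rw [abs_of_nonneg (by linarith)]
    linarith
  · have hqm : q - 1 < m := by omega
    have hcast : ((q - 1 : ℕ) : ℝ) = (q : ℝ) - 1 := by
      rw [Nat.cast_sub hq0]; simp
    refine (Finset.sum_eq_single (⟨q - 1, hqm⟩ : Fin m) ?_ ?_).trans ?_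
    · intro k _ hk
      rw [indicator_of_notMem, mul_zero]
      simp only [StepFun.riemann, NNReal.coe_div, NNReal.coe_mul, NNReal.coe_add,
        NNReal.coe_natCast, NNReal.coe_one, mem_Ioc, not_and, not_le]
      intro h1
      rw [div_lt_iff₀ hm'] at h1
      rw [div_lt_iff₀ hm']
      rw [div_lt_iff₀ hm'] at hlt'
      rw [le_div_iff₀ hm'] at hle'
      have h2 : (k : ℕ) < q := by
        have : (t : ℝ) * (k : ℕ) < t * q := by linarith
        exact_mod_cast lt_of_mul_lt_mul_left this ht.le
      have h3 : (k : ℕ) + 1 < q := by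
        have : (k : ℕ) ≠ q - 1 := fun h ↦ hk (Fin.ext h)
        omega
      have h4 : ((k : ℕ) : ℝ) + 1 ≤ q - 1 := by
        have : (k : ℕ) + 1 + 1 ≤ q := h3
        have : ((k : ℕ) : ℝ) + 1 + 1 ≤ q := by exact_mod_cast this
        linarith
      have := mul_le_mul_of_nonneg_left h4 ht.le
      linarith
    · exact fun h ↦ absurd (Finset.mem_univ (α := Fin m) _) h
    · rw [indicator_of_mem]
      · simp [StepFun.riemann, hcast]
      · simp only [StepFun.riemann, NNReal.coe_div, NNReal.coe_mul, NNReal.coe_add,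
          NNReal.coe_natCast, NNReal.coe_one, hcast, mem_Ioc, sub_add_cancel]
        exact ⟨hlt', hle'⟩

theorem StepFun.tendsto_riemann {g : ℝ → ℝ} {t : ℝ≥0} (hg : ContinuousOn g (Icc 0 (t : ℝ))) :
    Tendsto (fun m ↦ eLpNorm (fun s ↦ (StepFun.riemann g t m).eval s -
      (Ioc (0 : ℝ) t).indicator g s) 2 volume) atTop (𝓝 0) := by
  have huc := isCompact_Icc.uniformContinuousOn_of_continuous hg
  rw [Metric.uniformContinuousOn_iff] at huc
  have hbound : ∀ δ : ℝ, 0 < δ → ∀ᶠ m in atTop, eLpNorm (fun s ↦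
      (StepFun.riemann g t m).eval s - (Ioc (0 : ℝ) t).indicator g s) 2 volume ≤
        ENNReal.ofReal δ * (t : ℝ≥0∞) ^ (1 / 2 : ℝ) := fun δ hδ ↦ by
    obtain ⟨η, hη, H⟩ := huc δ hδ
    have h1 : ∀ᶠ m : ℕ in atTop, (t : ℝ) / m < η :=
      (tendsto_const_div_atTop_nhds_zero_nat (t : ℝ)).eventually_lt_const hη
    filter_upwards [h1, eventually_gt_atTop 0] with m hm hm0
    have hle : ∀ s, ‖(StepFun.riemann g t m).eval s - (Ioc (0 : ℝ) t).indicator g s‖ ≤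
        ‖(Ioc (0 : ℝ) t).indicator (fun _ ↦ δ) s‖ := fun s ↦ by
      by_cases hs : s ∈ Ioc (0 : ℝ) t
      · obtain ⟨r, hr, hrs, he⟩ := StepFun.riemann_eval_of_mem g t hm0 hs
        rw [he, indicator_of_mem hs, indicator_of_mem hs, ← dist_eq_norm, Real.norm_of_nonneg hδ.le]
        exact (H r hr s ⟨hs.1.le, hs.2⟩ (by rw [Real.dist_eq]; linarith)).le
      · simp [indicator_of_notMem hs, StepFun.riemann_eval_of_notMem g t m hs]
    refine (eLpNorm_mono hle).trans ?_
    rw [eLpNorm_indicator_const measurableSet_Ioc two_ne_zero ENNReal.ofNat_ne_top,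
      Real.volume_Ioc, Real.enorm_of_nonneg hδ.le]
    simp
  rw [ENNReal.tendsto_nhds_zero]
  intro e he
  have ht : (t : ℝ≥0∞) ^ (1 / 2 : ℝ) ≠ ∞ := by simp
  have hlim : Tendsto (fun δ : ℝ ↦ ENNReal.ofReal δ * (t : ℝ≥0∞) ^ (1 / 2 : ℝ)) (𝓝[>] 0) (𝓝 0) := by
    have := ENNReal.Tendsto.mul_const (b := (t : ℝ≥0∞) ^ (1 / 2 : ℝ))
      ((ENNReal.continuous_ofReal.tendsto 0).mono_left (nhdsWithin_le_nhds (s := Ioi 0)))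
      (Or.inr ht)
    simpa using this
  obtain ⟨δ, hδ, hδ0⟩ := ((hlim.eventually_le_const he).and self_mem_nhdsWithin).exists
  filter_upwards [hbound δ hδ0] with m hm using hm.trans hδ

/-- Existence of the Wiener integral of an integrand which is continuous on `[0,t]`. -/
theorem exists_isWienerIntegral (hW : IsPreBrownianReal W P) {g : ℝ → ℝ} {t : ℝ≥0}
    (hg : ContinuousOn g (Icc 0 (t : ℝ))) : ∃ X, IsWienerIntegral W P g t X := by
  set S : ℕ → StepFun := fun m ↦ StepFun.riemann g t m with hS
  have hlim : Tendsto (fun m ↦ eLpNorm (fun s ↦ (S m).eval s -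
      (Ioc (0 : ℝ) t).indicator g s) 2 volume) atTop (𝓝 0) := StepFun.tendsto_riemann hg
  have hgm : AEStronglyMeasurable ((Ioc (0 : ℝ) t).indicator g) volume :=
    (aestronglyMeasurable_indicator_iff measurableSet_Ioc).2
      ((hg.mono Ioc_subset_Icc_self).aestronglyMeasurable measurableSet_Ioc)
  set h := (Ioc (0 : ℝ) t).indicator g
  set F : ℕ → Lp ℝ 2 P := fun m ↦ ((S m).memLp_integral hW).toLp _ with hF
  have hdist : ∀ m k, edist (F m) (F k) ≤ eLpNorm (fun s ↦ (S m).eval s - h s) 2 volume +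
      eLpNorm (fun s ↦ (S k).eval s - h s) 2 volume := fun m k ↦ by
    rw [hF, Lp.edist_toLp_toLp]
    refine ((S m).isometry hW (S k)).le.trans ?_
    change eLpNorm ((S m).eval - (S k).eval) 2 volume ≤ _
    have e' : (S m).eval - (S k).eval = ((S m).eval - h) + (-((S k).eval - h)) := by abel
    rw [e']
    refine (eLpNorm_add_le ((S m).memLp_eval.aestronglyMeasurable.sub hgm)
      ((S k).memLp_eval.aestronglyMeasurable.sub hgm).neg one_le_two).trans ?_
    rw [eLpNorm_neg]
    exact le_rfl
  have hcau : CauchySeq F := by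
    rw [EMetric.cauchySeq_iff]
    intro e he
    have he2 : 0 < e / 2 := ENNReal.half_pos he.ne'
    obtain ⟨N, hN⟩ := eventually_atTop.1 (hlim.eventually_lt_const he2)
    refine ⟨N, fun m hm k hk ↦ (hdist m k).trans_lt ?_⟩
    rw [← ENNReal.add_halves e]
    exact ENNReal.add_lt_add (hN m hm) (hN k hk)
  obtain ⟨X, hX⟩ := cauchySeq_tendsto_of_complete hcau
  refine ⟨X, Lp.memLp X, S, hlim, ?_⟩
  rw [tendsto_iff_edist_tendsto_0] at hX
  refine hX.congr fun m ↦ ?_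
  rw [Lp.edist_def]
  refine eLpNorm_congr_ae ?_
  filter_upwards [((S m).memLp_integral hW).coeFn_toLp] with ω hω
  simp [hF, hω]

theorem isWienerIntegral_wienerIntegral (hW : IsPreBrownianReal W P) {g : ℝ → ℝ} {t : ℝ≥0}
    (hg : ContinuousOn g (Icc 0 (t : ℝ))) :
    IsWienerIntegral W P g t (wienerIntegral W P g t) := by
  have h := exists_isWienerIntegral hW hg
  rw [wienerIntegral, dif_pos h]
  exact h.choose_spec

end Wellposed

/-! ### Function class, models and risk -/

/-- The class `C^b(α, L, [l, u])` of functions on `[0,1]`: with `p = ⌊α⌋`, the derivative `f⁽ᵖ⁾`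
exists on `[0,1]` (one-sided at the endpoints) and satisfies
`|f⁽ᵖ⁾(x) - f⁽ᵖ⁾(y)| ≤ L |x - y|^(α - p)`, and `l ≤ f ≤ u`. -/
def boundedHolder (α L l u : ℝ) : Set (ℝ → ℝ) :=
  {f | (∀ k < ⌊α⌋₊, DifferentiableOn ℝ (iteratedDerivWithin k f (Icc 0 1)) (Icc 0 1)) ∧
    (∀ x ∈ Icc (0 : ℝ) 1, ∀ y ∈ Icc (0 : ℝ) 1,
      |iteratedDerivWithin ⌊α⌋₊ f (Icc 0 1) x - iteratedDerivWithin ⌊α⌋₊ f (Icc 0 1) y|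
        ≤ L * |x - y| ^ (α - (⌊α⌋₊ : ℝ))) ∧
    ∀ x ∈ Icc (0 : ℝ) 1, l ≤ f x ∧ f x ≤ u}

/-- The sampling time `i/n`, where the index `i : Fin n` stands for `i + 1 ∈ {1, …, n}`. -/
def obsTime {n : ℕ} (i : Fin n) : ℝ≥0 := ((i : ℕ) + 1 : ℝ≥0) / n

/-- The observations `Y_i = ∫₀^{i/n} σ dW + τ ε_i` with `σ = √f`, `i = 1, …, n`. -/
def obsIntegral {Ω : Type*} [MeasurableSpace Ω] (P : Measure Ω) (W : ℝ≥0 → Ω → ℝ) (τ : ℝ)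
    {n : ℕ} (ε : Fin n → Ω → ℝ) (f : ℝ → ℝ) (ω : Ω) (i : Fin n) : ℝ :=
  wienerIntegral W P (fun s ↦ √(f s)) (obsTime i) ω + τ * ε i ω

/-- The observations `Ỹ_i = σ(i/n) W_{i/n} + τ ε_i` with `σ = √f`, `i = 1, …, n`. -/
def obsProduct {Ω : Type*} (W : ℝ≥0 → Ω → ℝ) (τ : ℝ)
    {n : ℕ} (ε : Fin n → Ω → ℝ) (f : ℝ → ℝ) (ω : Ω) (i : Fin n) : ℝ :=
  √(f (obsTime i)) * W (obsTime i) ω + τ * ε i ω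

/-- The squared loss `‖g - f‖₂² = ∫₀¹ (g(t) - f(t))² dt`. -/
def sqLoss (g f : ℝ → ℝ) : ℝ≥0∞ := ∫⁻ t in Icc (0 : ℝ) 1, ENNReal.ofReal ((g t - f t) ^ 2)

/-- The normalized minimax risk
`inf_T sup_{f ∈ F} E[r ‖T(Y^f) - f‖²_{L²[0,1]}]`, where `Y f` is the vector of the `n` observations
when `σ² = f` is the true function, and `T` runs through all estimators, i.e. all (jointly
measurable) functions of the data with values in the functions on `[0,1]`. -/
def minimaxRisk {Ω : Type*} [MeasurableSpace Ω] (P : Measure Ω) (r : ℝ) (F : Set (ℝ → ℝ)) {n : ℕ}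
    (Y : (ℝ → ℝ) → Ω → Fin n → ℝ) : ℝ≥0∞ :=
  ⨅ (T : (Fin n → ℝ) → ℝ → ℝ) (_ : Measurable (Function.uncurry T)), ⨆ f ∈ F,
    ∫⁻ ω, ENNReal.ofReal r * sqLoss (T (Y f ω)) f ∂P

end

end VolatilityModel

/-!
The lower bound comes from Assouad's lemma on the hypercube of functions
`l + A ∑ k, θ k ψ (m x - k)` with `θ k ∈ {0, 1}`, where `ψ` is a smooth bump and `A ∼ m ^ (-α)`, so
that every vertex is in the Hölder class. Switching one bump costs `A ^ 2 / m` in squared `L²` loss,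
up to a constant, hence the risk is at least of order `A ^ 2` as soon as the laws of the
observations at adjacent vertices are not perfectly distinguishable.

In both models the observations are a linear image of a standard Gaussian vector of signal and noise
coordinates. The law at the adjacent vertex is the image under the same map of the Gaussian measure
transported by a matrix of determinant one, whose Kullback-Leibler divergence from the standard
Gaussian measure is half the excess of its squared Hilbert-Schmidt norm over the dimension.
Correcting the discrepancy entirely in the noise is too expensive at large time lags, and correcting
it entirely in the signal at small ones. Passing from the noise to the signal along a ramp of `√n`
sampling steps makes the excess of order `A ^ 2 √n / m`, which is bounded for
`m ∼ n ^ (1 / (4 α + 2))`. The resulting bound `A ^ 2` is then of order `n ^ (-α / (2 α + 1))`.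
-/

namespace VolatilityModel

noncomputable section

/-! ### Testing affinity -/

section Affinity

variable {α β : Type*} [MeasurableSpace α] [MeasurableSpace β]

theorem mul_inf_univ_le_lintegral_add {μ ν : Measure α} {f g : α → ℝ≥0∞} (hf : Measurable f)
    {D : ℝ≥0∞} (hD : ∀ x, D ≤ f x + g x) :
    D * (μ ⊓ ν) univ ≤ ∫⁻ x, f x ∂μ + ∫⁻ x, g x ∂ν :=
  calc D * (μ ⊓ ν) univ
      = ∫⁻ _, D ∂(μ ⊓ ν) := (lintegral_const D).symm
    _ ≤ ∫⁻ x, (f x + g x) ∂(μ ⊓ ν) := lintegral_mono hD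
    _ = ∫⁻ x, f x ∂(μ ⊓ ν) + ∫⁻ x, g x ∂(μ ⊓ ν) := lintegral_add_left hf g
    _ ≤ ∫⁻ x, f x ∂μ + ∫⁻ x, g x ∂ν :=
        add_le_add (lintegral_mono' inf_le_left le_rfl) (lintegral_mono' inf_le_right le_rfl)

theorem inf_univ_le_inf_map_univ {μ ν : Measure α} {f : α → β} (hf : Measurable f) :
    (μ ⊓ ν) univ ≤ (μ.map f ⊓ ν.map f) univ :=
  calc (μ ⊓ ν) univ = ((μ ⊓ ν).map f) univ := by rw [Measure.map_apply hf .univ, preimage_univ]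
    _ ≤ (μ.map f ⊓ ν.map f) univ :=
        le_inf (Measure.map_mono inf_le_left hf) (Measure.map_mono inf_le_right hf) univ

theorem lintegral_min_one_le_inf_map_univ {μ : Measure α} {f : α → α} (hf : Measurable f)
    {g : α → ℝ≥0∞} (hg : (μ.withDensity g).map f = μ) :
    ∫⁻ x, min 1 (g x) ∂μ ≤ (μ ⊓ μ.map f) univ := by
  have hle₁ : (μ.withDensity fun x ↦ min 1 (g x)).map f ≤ μ :=
    (Measure.map_mono (withDensity_mono (ae_of_all _ fun _ ↦ min_le_right _ _)) hf).trans_eq hg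
  have hle₂ : (μ.withDensity fun x ↦ min 1 (g x)).map f ≤ μ.map f := by
    refine Measure.map_mono ?_ hf
    exact (withDensity_mono (ae_of_all _ fun _ ↦ min_le_left _ _)).trans_eq withDensity_one
  calc ∫⁻ x, min 1 (g x) ∂μ
      = ((μ.withDensity fun x ↦ min 1 (g x)).map f) univ := by
        rw [Measure.map_apply hf .univ, preimage_univ, withDensity_apply _ .univ,
          Measure.restrict_univ]
    _ ≤ (μ ⊓ μ.map f) univ := le_inf hle₁ hle₂ univ

theorem one_sub_half_le_min_one_exp_neg (v : ℝ) :
    1 - v / 2 ≤ 15 / 8 * min 1 (Real.exp (-v)) + (1 + Real.exp (-v)) / 8 := by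
  have hlin : 1 - v / 2 ≤ Real.exp (-(v / 2)) := by linarith [Real.add_one_le_exp (-(v / 2))]
  have hsq : Real.exp (-v) = Real.exp (-(v / 2)) ^ 2 := by
    rw [← Real.exp_nat_mul]; congr 1; push_cast; ring
  rw [hsq]
  rcases min_cases 1 (Real.exp (-(v / 2)) ^ 2) with ⟨h, _⟩ | ⟨h, _⟩ <;> rw [h]
  · nlinarith [sq_nonneg (Real.exp (-(v / 2)) - 4)]
  · nlinarith [sq_nonneg (Real.exp (-(v / 2)) - 1 / 4)]

theorem quarter_le_lintegral_min_one_exp_neg {μ : Measure α} [IsProbabilityMeasure μ]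
    {V : α → ℝ} (hV : Integrable V μ) (hV_half : ∫ x, V x ∂μ ≤ 1 / 2)
    (hexp : ∫⁻ x, ENNReal.ofReal (Real.exp (-V x)) ∂μ ≤ 1) :
    ENNReal.ofReal (1 / 4) ≤ ∫⁻ x, min 1 (ENNReal.ofReal (Real.exp (-V x))) ∂μ := by
  have hexp_nonneg : 0 ≤ᵐ[μ] fun x ↦ Real.exp (-V x) := ae_of_all _ fun x ↦ (Real.exp_pos _).le
  have hexp_meas : AEStronglyMeasurable (fun x ↦ Real.exp (-V x)) μ :=
    Real.continuous_exp.comp_aestronglyMeasurable hV.aestronglyMeasurable.neg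
  have hexp_int : Integrable (fun x ↦ Real.exp (-V x)) μ :=
    (lintegral_ofReal_ne_top_iff_integrable hexp_meas hexp_nonneg).1
      (hexp.trans_lt ENNReal.one_lt_top).ne
  have hexp_le : ∫ x, Real.exp (-V x) ∂μ ≤ 1 := by
    rw [integral_eq_lintegral_of_nonneg_ae hexp_nonneg hexp_meas]
    exact ENNReal.toReal_mono ENNReal.one_ne_top hexp
  have hmin_int : Integrable (fun x ↦ min 1 (Real.exp (-V x))) μ :=
    (integrable_const (1 : ℝ)).inf hexp_int
  have hone_add_int : Integrable (fun x ↦ 1 + Real.exp (-V x)) μ :=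
    (integrable_const (1 : ℝ)).add hexp_int
  have hmono : ∫ x, (1 - V x / 2) ∂μ ≤
      ∫ x, (15 / 8 * min 1 (Real.exp (-V x)) + (1 + Real.exp (-V x)) / 8) ∂μ :=
    integral_mono ((integrable_const (1 : ℝ)).sub (hV.div_const 2))
      ((hmin_int.const_mul _).add (hone_add_int.div_const 8))
      fun x ↦ one_sub_half_le_min_one_exp_neg (V x)
  rw [integral_sub (integrable_const (1 : ℝ)) (hV.div_const 2), integral_div,
    integral_add (hmin_int.const_mul _) (hone_add_int.div_const 8), integral_const_mul,
    integral_div, integral_add (integrable_const (1 : ℝ)) hexp_int, integral_const,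
    probReal_univ, one_smul] at hmono
  calc ENNReal.ofReal (1 / 4)
      ≤ ENNReal.ofReal (∫ x, min 1 (Real.exp (-V x)) ∂μ) :=
        ENNReal.ofReal_le_ofReal (by linarith)
    _ = ∫⁻ x, ENNReal.ofReal (min 1 (Real.exp (-V x))) ∂μ :=
        ofReal_integral_eq_lintegral_ofReal hmin_int
          (ae_of_all _ fun x ↦ le_min zero_le_one (Real.exp_pos _).le)
    _ = ∫⁻ x, min 1 (ENNReal.ofReal (Real.exp (-V x))) ∂μ := by
        simp only [ENNReal.ofReal_min, ENNReal.ofReal_one]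

end Affinity

/-! ### The standard Gaussian measure and unimodular matrices -/

/-- The law of a family of independent standard Gaussian variables indexed by `ι`. -/
abbrev stdGaussianPi (ι : Type*) [Fintype ι] : Measure (ι → ℝ) :=
  Measure.pi fun _ ↦ gaussianReal 0 1

section GaussianPi

variable {ι : Type*} [Fintype ι]

theorem stdGaussianPi_eq_withDensity :
    stdGaussianPi ι =
      volume.withDensity fun x ↦ ENNReal.ofReal (∏ i, gaussianPDFReal 0 1 (x i)) := by
  refine Measure.pi_eq fun s hs ↦ ?_
  rw [withDensity_apply _ (MeasurableSet.univ_pi hs), volume_pi, Measure.restrict_pi_pi,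
    ← ofReal_integral_eq_lintegral_ofReal, integral_fintype_prod_eq_prod,
    ENNReal.ofReal_prod_of_nonneg]
  · exact Finset.prod_congr rfl fun i _ ↦ (gaussianReal_apply_eq_integral 0 one_ne_zero _).symm
  · exact fun i _ ↦ integral_nonneg fun x ↦ gaussianPDFReal_nonneg 0 1 x
  · exact Integrable.fintype_prod fun i ↦ (integrable_gaussianPDFReal 0 1).restrict
  · exact ae_of_all _ fun x ↦ Finset.prod_nonneg fun i _ ↦ gaussianPDFReal_nonneg 0 1 _

theorem prod_gaussianPDFReal (x : ι → ℝ) :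
    ∏ i, gaussianPDFReal 0 1 (x i) =
      (√(2 * Real.pi))⁻¹ ^ Fintype.card ι * Real.exp (-(∑ i, x i ^ 2) / 2) := by
  simp only [gaussianPDFReal, NNReal.coe_one, mul_one, sub_zero, Finset.prod_mul_distrib,
    Finset.prod_const, Finset.card_univ, ← Real.exp_sum, ← Finset.sum_div,
    Finset.sum_neg_distrib]

theorem memLp_const_mul_gaussianReal (c : ℝ) : MemLp (fun x ↦ c * x) 2 (gaussianReal 0 1) :=
  (memLp_id_gaussianReal' 2 (by simp)).const_mul c

theorem memLp_const_mul_eval_stdGaussianPi (c : ℝ) (i : ι) :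
    MemLp (fun x ↦ c * x i) 2 (stdGaussianPi ι) :=
  (memLp_const_mul_gaussianReal c).comp_measurePreserving
    (measurePreserving_eval (fun _ ↦ gaussianReal 0 1) i)

theorem memLp_dotProduct_stdGaussianPi (c : ι → ℝ) :
    MemLp (fun x ↦ c ⬝ᵥ x) 2 (stdGaussianPi ι) :=
  memLp_finsetSum _ fun i _ ↦ memLp_const_mul_eval_stdGaussianPi (c i) i

theorem integral_dotProduct_sq_stdGaussianPi (c : ι → ℝ) :
    ∫ x, (c ⬝ᵥ x) ^ 2 ∂stdGaussianPi ι = ∑ i, c i ^ 2 := by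
  have hmean : ∫ x, c ⬝ᵥ x ∂stdGaussianPi ι = 0 := by
    simp only [dotProduct]
    rw [integral_finsetSum _ fun i _ ↦
      (memLp_const_mul_eval_stdGaussianPi (c i) i).integrable one_le_two]
    refine Finset.sum_eq_zero fun i _ ↦ ?_
    rw [integral_const_mul, integral_comp_eval (μ := fun _ : ι ↦ gaussianReal 0 1) (i := i)
      (f := fun y ↦ y) (by fun_prop), integral_id_gaussianReal, mul_zero]
  have hvar := variance_sum_pi (μ := fun _ : ι ↦ gaussianReal 0 1) (X := fun i x ↦ c i * x)
    fun i ↦ memLp_const_mul_gaussianReal (c i)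
  have hsum : (∑ i, fun x : ι → ℝ ↦ c i * x i) = fun x ↦ c ⬝ᵥ x := by
    ext x; simp only [Finset.sum_apply, dotProduct]
  rw [hsum, variance_of_integral_eq_zero (memLp_dotProduct_stdGaussianPi c).aemeasurable
    hmean] at hvar
  rw [hvar]
  refine Finset.sum_congr rfl fun i _ ↦ ?_
  rw [variance_const_mul, variance_fun_id_gaussianReal, NNReal.coe_one, mul_one]

theorem measurable_mulVec (M : Matrix ι ι ℝ) : Measurable fun x : ι → ℝ ↦ M.mulVec x := by
  simp only [measurable_pi_iff, Matrix.mulVec, dotProduct]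
  fun_prop

/-- The log-likelihood ratio between the standard Gaussian measure and its image under `M`,
evaluated at the image point `M x`, when `M` has determinant one. -/
def gaussianLogRatio (M : Matrix ι ι ℝ) (x : ι → ℝ) : ℝ :=
  (∑ i, M.mulVec x i ^ 2 - ∑ i, x i ^ 2) / 2

theorem measurable_gaussianLogRatio (M : Matrix ι ι ℝ) : Measurable (gaussianLogRatio M) := by
  have hM := measurable_mulVec M
  unfold gaussianLogRatio
  fun_prop

theorem integrable_sum_mulVec_sq (M : Matrix ι ι ℝ) :
    Integrable (fun x ↦ ∑ i, M.mulVec x i ^ 2) (stdGaussianPi ι) :=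
  integrable_finsetSum _ fun i _ ↦ (memLp_dotProduct_stdGaussianPi (M i)).integrable_sq

theorem integral_sum_mulVec_sq (M : Matrix ι ι ℝ) :
    ∫ x, ∑ i, M.mulVec x i ^ 2 ∂stdGaussianPi ι = ∑ i, ∑ j, M i j ^ 2 := by
  have hrow : ∀ i, Integrable (fun x ↦ M.mulVec x i ^ 2) (stdGaussianPi ι) := fun i ↦
    (memLp_dotProduct_stdGaussianPi (M i)).integrable_sq
  rw [integral_finsetSum _ fun i _ ↦ hrow i]
  exact Finset.sum_congr rfl fun i _ ↦ integral_dotProduct_sq_stdGaussianPi (M i)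

theorem integrable_sum_sq_stdGaussianPi :
    Integrable (fun x ↦ ∑ i, x i ^ 2) (stdGaussianPi ι) := by
  classical
  simpa only [Matrix.one_mulVec] using integrable_sum_mulVec_sq (1 : Matrix ι ι ℝ)

theorem integrable_gaussianLogRatio (M : Matrix ι ι ℝ) :
    Integrable (gaussianLogRatio M) (stdGaussianPi ι) :=
  ((integrable_sum_mulVec_sq M).sub integrable_sum_sq_stdGaussianPi).div_const 2

theorem integral_gaussianLogRatio (M : Matrix ι ι ℝ) :
    ∫ x, gaussianLogRatio M x ∂stdGaussianPi ι = (∑ i, ∑ j, M i j ^ 2 - Fintype.card ι) / 2 := by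
  classical
  have hone : ∫ x, ∑ i, x i ^ 2 ∂stdGaussianPi ι = Fintype.card ι := by
    simpa [Matrix.one_apply, ite_pow] using integral_sum_mulVec_sq (1 : Matrix ι ι ℝ)
  simp only [gaussianLogRatio]
  rw [integral_div, integral_sub (integrable_sum_mulVec_sq M) integrable_sum_sq_stdGaussianPi,
    integral_sum_mulVec_sq, hone]

variable [DecidableEq ι]

theorem map_mulVec_withDensity_stdGaussianPi {M : Matrix ι ι ℝ} (hM : M.det = 1) :
    ((stdGaussianPi ι).withDensity fun x ↦ ENNReal.ofReal (Real.exp (-gaussianLogRatio M x))).map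
      M.mulVec = stdGaussianPi ι := by
  have hvol : Measure.map M.mulVec volume = volume := by
    have h := Real.map_matrix_volume_pi_eq_smul_volume_pi (M := M) (by simp [hM])
    rwa [hM, inv_one, abs_one, ENNReal.ofReal_one, one_smul] at h
  have hpdf : Measurable fun x : ι → ℝ ↦ ENNReal.ofReal (∏ i, gaussianPDFReal 0 1 (x i)) :=
    ENNReal.measurable_ofReal.comp <| Finset.measurable_fun_prod _ fun i _ ↦
      (measurable_gaussianPDFReal 0 1).comp (measurable_pi_apply i)
  have hratio : ∀ x : ι → ℝ, ENNReal.ofReal (∏ i, gaussianPDFReal 0 1 (x i)) *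
      ENNReal.ofReal (Real.exp (-gaussianLogRatio M x)) =
        ENNReal.ofReal (∏ i, gaussianPDFReal 0 1 (M.mulVec x i)) := fun x ↦ by
    rw [prod_gaussianPDFReal, prod_gaussianPDFReal, ← ENNReal.ofReal_mul (by positivity),
      mul_assoc, ← Real.exp_add]
    congr 3
    unfold gaussianLogRatio; ring
  have hV := measurable_gaussianLogRatio M
  have hMm := measurable_mulVec M
  rw [stdGaussianPi_eq_withDensity, ← withDensity_mul _ hpdf (by fun_prop)]
  ext s hs
  rw [Measure.map_apply hMm hs, withDensity_apply _ (hMm hs), withDensity_apply _ hs]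
  nth_rw 2 [← hvol]
  rw [setLIntegral_map hs hpdf hMm]
  exact lintegral_congr hratio

/-- The hypothesis bounds the Kullback-Leibler divergence of the two measures by `1/2`. -/
theorem quarter_le_inf_map_mulVec_univ {M : Matrix ι ι ℝ} (hM : M.det = 1)
    (hM_sq : ∑ i, ∑ j, M i j ^ 2 ≤ Fintype.card ι + 1) :
    ENNReal.ofReal (1 / 4) ≤ (stdGaussianPi ι ⊓ (stdGaussianPi ι).map M.mulVec) univ := by
  have hmap := map_mulVec_withDensity_stdGaussianPi hM
  have hmass := congrArg (· univ) hmap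
  simp only [Measure.map_apply (measurable_mulVec M) .univ, preimage_univ,
    withDensity_apply _ .univ, Measure.restrict_univ, measure_univ] at hmass
  refine (quarter_le_lintegral_min_one_exp_neg (integrable_gaussianLogRatio M) ?_
    hmass.le).trans (lintegral_min_one_le_inf_map_univ (measurable_mulVec M) hmap)
  rw [integral_gaussianLogRatio]
  linarith

end GaussianPi

/-! ### Convergence in `L²` -/

section L2

variable {α : Type*} [MeasurableSpace α] {μ : Measure α}

theorem integral_sq_eq_toReal_eLpNorm_sq {f : α → ℝ} (hf : MemLp f 2 μ) :
    ∫ x, f x ^ 2 ∂μ = (eLpNorm f 2 μ).toReal ^ 2 := by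
  have hnonneg : 0 ≤ ∫ x, f x ^ 2 ∂μ := integral_nonneg fun x ↦ sq_nonneg _
  rw [hf.eLpNorm_eq_integral_rpow_norm two_ne_zero ENNReal.ofNat_ne_top]
  simp only [ENNReal.toReal_ofNat, Real.rpow_ofNat, Real.norm_eq_abs, sq_abs]
  rw [ENNReal.toReal_ofReal (by positivity), ← Real.rpow_natCast, ← Real.rpow_mul hnonneg]
  norm_num

theorem tendsto_integral_sq_of_tendsto_eLpNorm {f : ℕ → α → ℝ} {g : α → ℝ}
    (hf : ∀ m, MemLp (f m) 2 μ) (hg : MemLp g 2 μ)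
    (h : Tendsto (fun m ↦ eLpNorm (fun x ↦ f m x - g x) 2 μ) atTop (𝓝 0)) :
    Tendsto (fun m ↦ ∫ x, f m x ^ 2 ∂μ) atTop (𝓝 (∫ x, g x ^ 2 ∂μ)) := by
  have hLp := ((Lp.tendsto_Lp_iff_tendsto_eLpNorm'' f hf g hg).2 h).norm.pow 2
  simpa only [Lp.norm_toLp, ← integral_sq_eq_toReal_eLpNorm_sq (hf _),
    ← integral_sq_eq_toReal_eLpNorm_sq hg] using hLp

theorem tendsto_eLpNorm_add_sub {f g : ℕ → α → ℝ} {F G : α → ℝ} (hf : ∀ m, MemLp (f m) 2 μ)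
    (hg : ∀ m, MemLp (g m) 2 μ) (hF : MemLp F 2 μ) (hG : MemLp G 2 μ)
    (hfF : Tendsto (fun m ↦ eLpNorm (fun x ↦ f m x - F x) 2 μ) atTop (𝓝 0))
    (hgG : Tendsto (fun m ↦ eLpNorm (fun x ↦ g m x - G x) 2 μ) atTop (𝓝 0)) :
    Tendsto (fun m ↦ eLpNorm (fun x ↦ f m x + g m x - (F x + G x)) 2 μ) atTop (𝓝 0) := by
  have hsum := hfF.add hgG
  rw [add_zero] at hsum
  refine tendsto_of_tendsto_of_tendsto_of_le_of_le tendsto_const_nhds hsum (fun _ ↦ zero_le)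
    fun m ↦ ?_
  have hrearrange : (fun x ↦ f m x + g m x - (F x + G x)) = (f m - F) + (g m - G) := by
    ext x; simp only [Pi.add_apply, Pi.sub_apply]; ring
  rw [hrearrange]
  exact eLpNorm_add_le ((hf m).sub hF).aestronglyMeasurable ((hg m).sub hG).aestronglyMeasurable
    one_le_two

theorem tendsto_eLpNorm_const_mul_sub {f : ℕ → α → ℝ} {F : α → ℝ} (c : ℝ)
    (h : Tendsto (fun m ↦ eLpNorm (fun x ↦ f m x - F x) 2 μ) atTop (𝓝 0)) :
    Tendsto (fun m ↦ eLpNorm (fun x ↦ c * f m x - c * F x) 2 μ) atTop (𝓝 0) := by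
  have hc := ENNReal.Tendsto.const_mul (a := ‖c‖ₑ) h (Or.inr enorm_ne_top)
  rw [mul_zero] at hc
  refine hc.congr fun m ↦ ?_
  rw [← eLpNorm_const_smul]
  congr 1; ext x; simp only [Pi.smul_apply, smul_eq_mul, mul_sub]

end L2

/-! ### Limits of integrals of step functions -/

/-- The step function without steps. -/
instance : Zero StepFun :=
  ⟨⟨0, Fin.elim0, Fin.elim0, Fin.elim0, fun k ↦ k.elim0⟩⟩

/-- The sum of step functions as the concatenation of their steps, which need not be disjoint. -/
def StepFun.add (S T : StepFun) : StepFun where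
  size := S.size + T.size
  coef := Fin.append S.coef T.coef
  left := Fin.append S.left T.left
  right := Fin.append S.right T.right
  le := Fin.addCases (by simpa using S.le) (by simpa using T.le)

instance : Add StepFun := ⟨StepFun.add⟩

/-- Scalar multiples of step functions. -/
instance : SMul ℝ StepFun where
  smul c S := { S with coef := fun k ↦ c * S.coef k }

section StepFun

variable {Ω : Type*} (W : ℝ≥0 → Ω → ℝ)

theorem StepFun.eval_zero (s : ℝ) : (0 : StepFun).eval s = 0 := Fin.sum_univ_zero _

theorem StepFun.integral_zero (ω : Ω) : (0 : StepFun).integral W ω = 0 := Fin.sum_univ_zero _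

theorem StepFun.eval_add (S T : StepFun) (s : ℝ) : (S + T).eval s = S.eval s + T.eval s := by
  refine (Fin.sum_univ_add (a := S.size) (b := T.size) _).trans ?_
  change (∑ k, (S.add T).coef _ * (Ioc ((S.add T).left _ : ℝ) ((S.add T).right _)).indicator _ _) +
    ∑ k, (S.add T).coef _ * (Ioc ((S.add T).left _ : ℝ) ((S.add T).right _)).indicator _ _ = _
  simp only [StepFun.add, Fin.append_left, Fin.append_right, StepFun.eval]

theorem StepFun.integral_add (S T : StepFun) (ω : Ω) :
    (S + T).integral W ω = S.integral W ω + T.integral W ω := by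
  refine (Fin.sum_univ_add (a := S.size) (b := T.size) _).trans ?_
  change (∑ k, (S.add T).coef _ * (W ((S.add T).right _) ω - W ((S.add T).left _) ω)) +
    ∑ k, (S.add T).coef _ * (W ((S.add T).right _) ω - W ((S.add T).left _) ω) = _
  simp only [StepFun.add, Fin.append_left, Fin.append_right, StepFun.integral]

theorem StepFun.eval_smul (c : ℝ) (S : StepFun) (s : ℝ) : (c • S).eval s = c * S.eval s := by
  simp only [StepFun.eval, Finset.mul_sum, ← mul_assoc]; rfl

theorem StepFun.integral_smul (c : ℝ) (S : StepFun) (ω : Ω) :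
    (c • S).integral W ω = c * S.integral W ω := by
  simp only [StepFun.integral, Finset.mul_sum, ← mul_assoc]; rfl

end StepFun

section StepLimits

variable {Ω : Type*} [MeasurableSpace Ω] {P : Measure Ω} {W : ℝ≥0 → Ω → ℝ}

/-- `X` is the `L²(P)`-limit of the integrals of step functions which converge to `G` in `L²`,
that is, `X` is a version of the Wiener integral of `G` over the whole time axis. -/
def IsStepLimit (W : ℝ≥0 → Ω → ℝ) (P : Measure Ω) (G : ℝ → ℝ) (X : Ω → ℝ) : Prop :=
  MemLp G 2 volume ∧ MemLp X 2 P ∧ ∃ S : ℕ → StepFun,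
    Tendsto (fun m ↦ eLpNorm (fun s ↦ (S m).eval s - G s) 2 volume) atTop (𝓝 0) ∧
    Tendsto (fun m ↦ eLpNorm (fun ω ↦ (S m).integral W ω - X ω) 2 P) atTop (𝓝 0)

theorem IsStepLimit.aemeasurable {G : ℝ → ℝ} {X : Ω → ℝ} (hX : IsStepLimit W P G X) :
    AEMeasurable X P :=
  hX.2.1.aemeasurable

theorem IsStepLimit.zero : IsStepLimit W P (fun _ ↦ 0) (fun _ ↦ 0) :=
  ⟨MemLp.zero, MemLp.zero, fun _ ↦ 0, by simp [StepFun.eval_zero],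
    by simp [StepFun.integral_zero]⟩

theorem IsStepLimit.add (hW : IsPreBrownianReal W P) {G H : ℝ → ℝ} {X Y : Ω → ℝ}
    (hX : IsStepLimit W P G X) (hY : IsStepLimit W P H Y) :
    IsStepLimit W P (fun s ↦ G s + H s) (fun ω ↦ X ω + Y ω) := by
  obtain ⟨hG, hXm, S, hSG, hSX⟩ := hX
  obtain ⟨hH, hYm, T, hTH, hTY⟩ := hY
  refine ⟨hG.add hH, hXm.add hYm, fun m ↦ S m + T m, ?_, ?_⟩
  · simp only [StepFun.eval_add]
    exact tendsto_eLpNorm_add_sub (fun m ↦ (S m).memLp_eval) (fun m ↦ (T m).memLp_eval) hG hH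
      hSG hTH
  · simp only [StepFun.integral_add]
    exact tendsto_eLpNorm_add_sub (fun m ↦ (S m).memLp_integral hW)
      (fun m ↦ (T m).memLp_integral hW) hXm hYm hSX hTY

theorem IsStepLimit.const_mul (c : ℝ) {G : ℝ → ℝ} {X : Ω → ℝ} (hX : IsStepLimit W P G X) :
    IsStepLimit W P (fun s ↦ c * G s) (fun ω ↦ c * X ω) := by
  obtain ⟨hG, hXm, S, hSG, hSX⟩ := hX
  refine ⟨hG.const_mul c, hXm.const_mul c, fun m ↦ c • S m, ?_, ?_⟩
  · simp only [StepFun.eval_smul]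
    exact tendsto_eLpNorm_const_mul_sub c hSG
  · simp only [StepFun.integral_smul]
    exact tendsto_eLpNorm_const_mul_sub c hSX

theorem IsStepLimit.sum (hW : IsPreBrownianReal W P) {ι : Type*} (s : Finset ι)
    {G : ι → ℝ → ℝ} {X : ι → Ω → ℝ} (hX : ∀ i ∈ s, IsStepLimit W P (G i) (X i)) :
    IsStepLimit W P (fun x ↦ ∑ i ∈ s, G i x) (fun ω ↦ ∑ i ∈ s, X i ω) := by
  classical
  induction s using Finset.induction_on with
  | empty => simpa using IsStepLimit.zero
  | insert a s ha ih =>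
    simp only [Finset.sum_insert ha]
    exact (hX a (by simp)).add hW (ih fun i hi ↦ hX i (by simp [hi]))

theorem StepFun.hasLaw_integral (hW : IsPreBrownianReal W P) (S : StepFun) :
    HasLaw (S.integral W) (gaussianReal 0 (∫ s, S.eval s ^ 2).toNNReal) P := by
  have hgauss : HasGaussianLaw (S.integral W) P := by
    have h := ((hW.isGaussianProcess.comp_right (Sum.elim S.right S.left)).smul
      (Sum.elim S.coef fun k ↦ -S.coef k)).hasGaussianLaw_fun_sum (I := Finset.univ)
    refine h.congr (ae_of_all _ fun ω ↦ ?_)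
    simp only [Fintype.sum_sum_type, Sum.elim_inl, Sum.elim_inr, smul_eq_mul, neg_mul,
      Finset.sum_neg_distrib, ← sub_eq_add_neg, ← Finset.sum_sub_distrib, StepFun.integral, mul_sub,
      Function.comp_apply]
  have hmean : ∫ ω, S.integral W ω ∂P = 0 := by
    have hint : ∀ t, Integrable (W t) P := fun t ↦ hW.integrable_eval t
    have hincr : ∀ k, Integrable
        (fun ω ↦ S.coef k * (W (S.right k) ω - W (S.left k) ω)) P := fun k ↦
      ((hint _).sub (hint _)).const_mul _
    simp only [StepFun.integral]
    rw [integral_finsetSum _ fun k _ ↦ hincr k]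
    refine Finset.sum_eq_zero fun k _ ↦ ?_
    rw [integral_const_mul, integral_sub (hint _) (hint _), hW.integral_eval, hW.integral_eval,
      sub_zero, mul_zero]
  refine ⟨hgauss.aemeasurable, ?_⟩
  rw [hgauss.map_eq_gaussianReal, hmean, variance_of_integral_eq_zero hgauss.aemeasurable hmean]
  exact congrArg (fun v ↦ gaussianReal 0 v.toNNReal)
    (integral_sq_sum_increments hW S.coef S.left S.right S.le)

theorem StepFun.charFun_map_integral_add (hW : IsPreBrownianReal W P) (S : StepFun) {Y : Ω → ℝ}
    (hY : AEMeasurable Y P) (hWY : IndepFun (fun ω t ↦ W t ω) Y P) (t : ℝ) :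
    charFun (P.map fun ω ↦ S.integral W ω + Y ω) t =
      Complex.exp (-(∫ s, S.eval s ^ 2 : ℝ) * t ^ 2 / 2) * charFun (P.map Y) t := by
  have hP : IsProbabilityMeasure P := hW.isGaussianProcess.isProbabilityMeasure
  have hind : IndepFun (S.integral W) Y P := by
    have hpath : Measurable fun w : ℝ≥0 → ℝ ↦ ∑ k, S.coef k * (w (S.right k) - w (S.left k)) := by
      fun_prop
    exact hWY.comp hpath measurable_id
  rw [hind.charFun_map_fun_add_eq_mul (S.memLp_integral hW).aemeasurable hY, Pi.mul_apply,
    (S.hasLaw_integral hW).map_eq, charFun_gaussianReal,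
    Real.coe_toNNReal _ (integral_nonneg fun s ↦ sq_nonneg _)]
  congr 2
  simp; ring

theorem tendsto_charFun_map_of_tendsto_eLpNorm [IsProbabilityMeasure P] {X : ℕ → Ω → ℝ}
    {Y : Ω → ℝ} (hX : ∀ m, AEMeasurable (X m) P) (hY : AEMeasurable Y P)
    (h : Tendsto (fun m ↦ eLpNorm (fun ω ↦ X m ω - Y ω) 2 P) atTop (𝓝 0)) (t : ℝ) :
    Tendsto (fun m ↦ charFun (P.map (X m)) t) atTop (𝓝 (charFun (P.map Y) t)) :=
  ProbabilityMeasure.tendsto_iff_tendsto_charFun.1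
    ((tendstoInMeasure_of_tendsto_eLpNorm two_ne_zero (fun m ↦ (hX m).aestronglyMeasurable)
      hY.aestronglyMeasurable h).tendstoInDistribution hX).tendsto t

theorem IsStepLimit.charFun_map_add (hW : IsPreBrownianReal W P) {G : ℝ → ℝ} {X Y : Ω → ℝ}
    (hX : IsStepLimit W P G X) (hY : AEMeasurable Y P) (hWY : IndepFun (fun ω t ↦ W t ω) Y P)
    (t : ℝ) :
    charFun (P.map fun ω ↦ X ω + Y ω) t =
      Complex.exp (-(∫ s, G s ^ 2 : ℝ) * t ^ 2 / 2) * charFun (P.map Y) t := by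
  have hP : IsProbabilityMeasure P := hW.isGaussianProcess.isProbabilityMeasure
  obtain ⟨hG, hXm, S, hSG, hSX⟩ := hX
  have hlhs := tendsto_charFun_map_of_tendsto_eLpNorm
    (X := fun m ω ↦ (S m).integral W ω + Y ω) (Y := fun ω ↦ X ω + Y ω)
    (fun m ↦ ((S m).memLp_integral hW).aemeasurable.add hY) (hXm.aemeasurable.add hY)
    (by simpa only [add_sub_add_right_eq_sub] using hSX) t
  have hvar := tendsto_integral_sq_of_tendsto_eLpNorm (fun m ↦ (S m).memLp_eval) hG hSG
  simp only [fun m ↦ (S m).charFun_map_integral_add hW hY hWY t] at hlhs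
  refine tendsto_nhds_unique hlhs (Tendsto.mul_const _ ?_)
  have hcexp : Continuous fun v : ℝ ↦ Complex.exp (-(v : ℂ) * t ^ 2 / 2) := by fun_prop
  exact (hcexp.tendsto _).comp hvar

theorem charFun_map_toLp {ι : Type*} [Fintype ι] {V : ι → Ω → ℝ}
    (hV : ∀ i, AEMeasurable (V i) P) (t : EuclideanSpace ℝ ι) :
    charFun ((P.map fun ω i ↦ V i ω).map (WithLp.toLp 2)) t =
      charFun (P.map fun ω ↦ ∑ i, t i * V i ω) 1 := by
  have hsum : AEMeasurable (fun ω ↦ ∑ i, t i * V i ω) P := by fun_prop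
  rw [charFun_apply, charFun_apply, integral_map (by fun_prop) (by fun_prop),
    integral_map (by fun_prop) (by fun_prop), integral_map hsum (by fun_prop)]
  simp [PiLp.inner_apply]

/-- The hypothesis `hG` says that the integrands `G i` are orthonormal in `L²`. -/
theorem hasLaw_sumElim_stdGaussianPi (hW : IsPreBrownianReal W P) {ι κ : Type*} [Fintype ι]
    [Fintype κ] {G : ι → ℝ → ℝ} {Z : ι → Ω → ℝ} {ε : κ → Ω → ℝ}
    (hZ : ∀ i, IsStepLimit W P (G i) (Z i))
    (hG : ∀ c : ι → ℝ, ∫ s, (∑ i, c i * G i s) ^ 2 = ∑ i, c i ^ 2)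
    (hε : ∀ k, HasLaw (ε k) (gaussianReal 0 1) P) (hindep : iIndepFun ε P)
    (hWε : IndepFun (fun ω t ↦ W t ω) (fun ω k ↦ ε k ω) P) :
    HasLaw (fun ω ↦ (Sum.elim (Z · ω) (ε · ω) : ι ⊕ κ → ℝ)) (stdGaussianPi (ι ⊕ κ)) P := by
  have hP : IsProbabilityMeasure P := hW.isGaussianProcess.isProbabilityMeasure
  have hZm : ∀ i, AEMeasurable (Z i) P := fun i ↦ (hZ i).aemeasurable
  have hεm : ∀ k, AEMeasurable (ε k) P := fun k ↦ (hε k).aemeasurable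
  have hmeas : AEMeasurable (fun ω ↦ (Sum.elim (Z · ω) (ε · ω) : ι ⊕ κ → ℝ)) P :=
    aemeasurable_pi_iff.2 (Sum.rec hZm hεm)
  have : IsProbabilityMeasure (P.map fun ω ↦ (Sum.elim (Z · ω) (ε · ω) : ι ⊕ κ → ℝ)) :=
    Measure.isProbabilityMeasure_map hmeas
  refine ⟨hmeas, charFun_eq_pi_iff.1 fun t ↦ ?_⟩
  have hsplit := charFun_map_toLp (V := fun i ω ↦ Sum.elim (Z · ω) (ε · ω) i)
    (Sum.rec hZm hεm) t
  have : IsProbabilityMeasure (P.map fun ω k ↦ ε k ω) :=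
    Measure.isProbabilityMeasure_map (aemeasurable_pi_iff.2 hεm)
  have hnoise := (charFun_map_toLp hεm (WithLp.toLp 2 fun k ↦ t (.inr k))).symm.trans
    (charFun_eq_pi_iff.2 (hindep.hasLaw_pi hε).map_eq _)
  have hsignal := IsStepLimit.sum hW Finset.univ fun i _ ↦ (hZ i).const_mul (t (.inl i))
  have hWY : IndepFun (fun ω t ↦ W t ω) (fun ω ↦ ∑ k, t (.inr k) * ε k ω) P := by
    have hcomb : Measurable fun e : κ → ℝ ↦ ∑ k, t (.inr k) * e k := by fun_prop
    exact hWε.comp measurable_id hcomb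
  simp only [Fintype.sum_sum_type, Sum.elim_inl, Sum.elim_inr] at hsplit
  rw [hsplit, hsignal.charFun_map_add hW (by fun_prop) hWY, hnoise, hG, Fintype.prod_sum_type]
  congr 1
  simp only [charFun_gaussianReal]
  rw [← Complex.exp_sum]
  congr 1
  push_cast
  rw [one_pow, mul_one, ← Finset.sum_neg_distrib, Finset.sum_div]
  exact Finset.sum_congr rfl fun i _ ↦ by simp; ring

end StepLimits

/-! ### Bins between sampling times -/

/-- The `k`-th time interval between consecutive sampling times, counted from `0`. -/
def bin (n k : ℕ) : Set ℝ := Ioc ((k : ℝ) / n) ((k + 1) / n)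

theorem measurableSet_bin (n k : ℕ) : MeasurableSet (bin n k) := measurableSet_Ioc

theorem pairwise_disjoint_bin (n : ℕ) : Pairwise (Function.onFun Disjoint (bin n)) := by
  have hmono : Monotone fun k : ℕ ↦ (k : ℝ) / n := fun i j hij ↦
    div_le_div_of_nonneg_right (Nat.cast_le.2 hij) n.cast_nonneg
  have hdisj := hmono.pairwise_disjoint_on_Ioc_succ
  simp only [Nat.succ_eq_succ, Nat.succ_eq_add_one, Nat.cast_add_one] at hdisj
  exact hdisj

theorem bin_subset_Icc {n : ℕ} (k : Fin n) : bin n k ⊆ Icc 0 1 := fun x hx ↦ by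
  refine ⟨le_trans (by positivity) hx.1.le, hx.2.trans (div_le_one_of_le₀ ?_ n.cast_nonneg)⟩
  exact_mod_cast k.2

theorem volume_bin (n k : ℕ) : volume (bin n k) = ENNReal.ofReal (1 / n) := by
  rw [bin, Real.volume_Ioc]
  congr 1; ring

theorem volume_real_bin (n k : ℕ) : volume.real (bin n k) = 1 / n := by
  rw [Measure.real, volume_bin, ENNReal.toReal_ofReal (by positivity)]

theorem indicator_Ioc_zero_sub (n k : ℕ) (g : ℝ → ℝ) (x : ℝ) :
    (Ioc 0 ((k + 1 : ℝ) / n)).indicator g x - (Ioc 0 ((k : ℝ) / n)).indicator g x =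
      (bin n k).indicator g x := by
  have hk : (k : ℝ) / n ≤ (k + 1) / n := by gcongr; linarith
  have hdisj : Disjoint (Ioc 0 ((k : ℝ) / n)) (bin n k) := Ioc_disjoint_Ioc_of_le le_rfl
  have hunion : Ioc 0 ((k : ℝ) / n) ∪ bin n k = Ioc 0 (((k : ℝ) + 1) / n) :=
    Ioc_union_Ioc_eq_Ioc (by positivity) hk
  rw [← hunion, indicator_union_of_disjoint hdisj, add_sub_cancel_left]

theorem sum_Iic_sub {n : ℕ} (X : ℕ → ℝ) (i : Fin n) :
    ∑ j ∈ Finset.Iic i, (X (j + 1) - X j) = X (i + 1) - X 0 := by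
  rw [← Finset.sum_range_sub X (i + 1), Nat.range_succ_eq_Iic, ← Fin.map_valEmbedding_Iic,
    Finset.sum_map]
  rfl

theorem integral_sq_sum_indicator {α ι : Type*} [MeasurableSpace α] {μ : Measure α} [Fintype ι]
    {B : ι → Set α} (hB : ∀ i, MeasurableSet (B i))
    (hB_disj : Pairwise (Function.onFun Disjoint B)) {g : α → ℝ}
    (hg : ∀ i, IntegrableOn (fun x ↦ g x ^ 2) (B i) μ) (c : ι → ℝ) :
    ∫ x, (∑ i, c i * (B i).indicator g x) ^ 2 ∂μ = ∑ i, c i ^ 2 * ∫ x in B i, g x ^ 2 ∂μ := by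
  have hcross : ∀ i j, j ≠ i → ∀ x, (B i).indicator g x * (B j).indicator g x = 0 := by
    intro i j hji x
    rw [← inter_indicator_mul, (hB_disj hji.symm).inter_eq, indicator_empty]
  have hsq : ∀ x, (∑ i, c i * (B i).indicator g x) ^ 2 =
      ∑ i, c i ^ 2 * (B i).indicator (fun x ↦ g x ^ 2) x := fun x ↦ by
    rw [sq, Finset.sum_mul_sum]
    refine Finset.sum_congr rfl fun i _ ↦ ?_
    rw [Finset.sum_eq_single_of_mem i (Finset.mem_univ i) fun j _ hji ↦ by
      rw [mul_mul_mul_comm, hcross i j hji, mul_zero]]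
    by_cases hx : x ∈ B i
    · simp only [indicator_of_mem hx]; ring
    · simp only [indicator_of_notMem hx]; ring
  simp only [hsq]
  rw [integral_finsetSum _ fun i _ ↦ ((integrable_indicator_iff (hB i)).2 (hg i)).const_mul _]
  simp only [integral_const_mul, integral_indicator (hB _)]

/-! ### Laws of the observations -/

/-- The data vector `a_i ∑_{j ≤ i} s_j z_j + τ e_i` as a function of `x = (z, e)`. For standard
Gaussian `x` it has the law of the observations in both models: there `a_i` is the factor in front
of the integral in the `i`-th observation and `s_j` is the standard deviation of its `j`-th
increment. -/
def obsMap {n : ℕ} (a s : Fin n → ℝ) (τ : ℝ) (x : Fin n ⊕ Fin n → ℝ) (i : Fin n) : ℝ :=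
  a i * ∑ j ∈ Finset.Iic i, s j * x (Sum.inl j) + τ * x (Sum.inr i)

/-- The law of `obsMap a s τ` under the standard Gaussian measure. -/
def obsLaw {n : ℕ} (a s : Fin n → ℝ) (τ : ℝ) : Measure (Fin n → ℝ) :=
  (stdGaussianPi (Fin n ⊕ Fin n)).map (obsMap a s τ)

theorem measurable_obsMap {n : ℕ} (a s : Fin n → ℝ) (τ : ℝ) : Measurable (obsMap a s τ) := by
  unfold obsMap; fun_prop

theorem hasLaw_obsMap {n : ℕ} (a s : Fin n → ℝ) (τ : ℝ) :
    HasLaw (obsMap a s τ) (obsLaw a s τ) (stdGaussianPi (Fin n ⊕ Fin n)) :=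
  ⟨(measurable_obsMap a s τ).aemeasurable, rfl⟩

theorem obsTime_eq {n : ℕ} (i : Fin n) : obsTime i = ((i + 1 : ℕ) : ℝ≥0) / n := by
  simp [obsTime]

section ObsLaw

variable {Ω : Type*} [MeasurableSpace Ω] {P : Measure Ω} {W : ℝ≥0 → Ω → ℝ}

theorem memLp_indicator_Ioc_of_continuousOn {g : ℝ → ℝ} {a b : ℝ}
    (hg : ContinuousOn g (Icc a b)) (p : ℝ≥0∞) : MemLp ((Ioc a b).indicator g) p volume := by
  rw [memLp_indicator_iff_restrict measurableSet_Ioc]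
  obtain ⟨C, hC⟩ := isCompact_Icc.exists_bound_of_continuousOn hg
  refine MemLp.of_bound ((hg.mono Ioc_subset_Icc_self).aestronglyMeasurable measurableSet_Ioc) C ?_
  exact (ae_restrict_iff' measurableSet_Ioc).2
    (ae_of_all _ fun x hx ↦ hC x (Ioc_subset_Icc_self hx))

theorem IsWienerIntegral.isStepLimit {g : ℝ → ℝ} {t : ℝ≥0} (hg : ContinuousOn g (Icc 0 t))
    {X : Ω → ℝ} (hX : IsWienerIntegral W P g t X) :
    IsStepLimit W P ((Ioc (0 : ℝ) t).indicator g) X :=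
  ⟨memLp_indicator_Ioc_of_continuousOn hg 2, hX⟩

theorem isWienerIntegral_one (hW : IsPreBrownianReal W P) (t : ℝ≥0) :
    IsWienerIntegral W P (fun _ ↦ 1) t (W t) := by
  refine ⟨(hW.isGaussianProcess.hasGaussianLaw_eval t).memLp_two,
    fun _ ↦ ⟨1, fun _ ↦ 1, fun _ ↦ 0, fun _ ↦ t, fun _ ↦ by simp⟩, ?_, ?_⟩
  · simp [StepFun.eval]
  · have hzero : (fun ω ↦ -W 0 ω) =ᵐ[P] 0 := by
      filter_upwards [hW.eval_zero_ae_eq_zero] with ω hω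
      simp [hω]
    simp [StepFun.integral, eLpNorm_congr_ae hzero]

theorem IsWienerIntegral.ae_eq_zero (hW : IsPreBrownianReal W P) {g : ℝ → ℝ} {X : Ω → ℝ}
    (hX : IsWienerIntegral W P g 0 X) : X =ᵐ[P] 0 := by
  refine hX.ae_eq hW (by simpa using aestronglyMeasurable_const) ⟨MemLp.zero, fun _ ↦ 0, ?_, ?_⟩
  · simp [StepFun.eval_zero]
  · simp [StepFun.integral_zero]

theorem IsWienerIntegral.isStepLimit_bin (hW : IsPreBrownianReal W P) {n : ℕ} {g : ℝ → ℝ}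
    (hg : ContinuousOn g (Icc 0 1)) {X : ℕ → Ω → ℝ}
    (hX : ∀ k ≤ n, IsWienerIntegral W P g ((k : ℝ≥0) / n) (X k)) (j : Fin n) :
    IsStepLimit W P ((bin n j).indicator g) (fun ω ↦ X (j + 1) ω - X j ω) := by
  have hlim : ∀ k ≤ n, IsStepLimit W P ((Ioc 0 ((k : ℝ) / n)).indicator g) (X k) := by
    intro k hk
    refine (hX k hk).isStepLimit (hg.mono (Icc_subset_Icc_right ?_))
    exact div_le_one_of_le₀ (by exact_mod_cast hk) (NNReal.coe_nonneg _)
  have h := (hlim (j + 1) j.2).add hW ((hlim j j.2.le).const_mul (-1))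
  simpa only [Nat.cast_add_one, neg_one_mul, ← sub_eq_add_neg, indicator_Ioc_zero_sub] using h

theorem hasLaw_obsLaw (hW : IsPreBrownianReal W P) {n : ℕ} {g : ℝ → ℝ}
    (hg : ContinuousOn g (Icc 0 1)) {X : ℕ → Ω → ℝ}
    (hX : ∀ k ≤ n, IsWienerIntegral W P g ((k : ℝ≥0) / n) (X k)) {s : Fin n → ℝ}
    (hs_ne : ∀ j, s j ≠ 0) (hs : ∀ j, s j ^ 2 = ∫ x in bin n j, g x ^ 2) {ε : Fin n → Ω → ℝ}
    (hε : ∀ i, HasLaw (ε i) (gaussianReal 0 1) P) (hindep : iIndepFun ε P)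
    (hWε : IndepFun (fun ω t ↦ W t ω) (fun ω i ↦ ε i ω) P) (a : Fin n → ℝ) (τ : ℝ) :
    HasLaw (fun ω i ↦ a i * X (i + 1) ω + τ * ε i ω) (obsLaw a s τ) P := by
  have hnormal : ∀ j, IsStepLimit W P (fun x ↦ (s j)⁻¹ * (bin n j).indicator g x)
      fun ω ↦ (s j)⁻¹ * (X (j + 1) ω - X j ω) := fun j ↦
    (IsWienerIntegral.isStepLimit_bin hW hg hX j).const_mul _
  have hint : ∀ j : Fin n, IntegrableOn (fun x ↦ g x ^ 2) (bin n j) := fun j ↦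
    (hg.pow 2).integrableOn_Icc.mono_set (bin_subset_Icc j)
  have horth : ∀ c : Fin n → ℝ,
      ∫ x, (∑ j, c j * ((s j)⁻¹ * (bin n j).indicator g x)) ^ 2 = ∑ j, c j ^ 2 := fun c ↦ by
    simp only [← mul_assoc]
    rw [integral_sq_sum_indicator (fun j : Fin n ↦ measurableSet_bin n j)
      (fun i j hij ↦ pairwise_disjoint_bin n (Fin.val_ne_of_ne hij)) hint]
    refine Finset.sum_congr rfl fun j _ ↦ ?_
    rw [← hs, ← mul_pow, inv_mul_cancel_right₀ (hs_ne j)]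
  have hlaw := (hasLaw_obsMap a s τ).comp
    (hasLaw_sumElim_stdGaussianPi hW hnormal horth hε hindep hWε)
  refine hlaw.congr ?_
  filter_upwards [(by simpa using hX 0 n.zero_le :
    IsWienerIntegral W P g 0 (X 0)).ae_eq_zero hW] with ω hω
  ext i
  simp only [Function.comp_apply, obsMap, Sum.elim_inl, Sum.elim_inr,
    mul_inv_cancel_left₀ (hs_ne _)]
  rw [sum_Iic_sub (X · ω), hω, Pi.zero_apply, sub_zero]

theorem hasLaw_obsIntegral (hW : IsPreBrownianReal W P) {n : ℕ} {f : ℝ → ℝ}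
    (hf : ContinuousOn f (Icc 0 1)) (hf_nonneg : ∀ x ∈ Icc (0 : ℝ) 1, 0 ≤ f x)
    (hf_pos : ∀ j : Fin n, 0 < ∫ x in bin n j, f x) {ε : Fin n → Ω → ℝ}
    (hε : ∀ i, HasLaw (ε i) (gaussianReal 0 1) P) (hindep : iIndepFun ε P)
    (hWε : IndepFun (fun ω t ↦ W t ω) (fun ω i ↦ ε i ω) P) (τ : ℝ) :
    HasLaw (obsIntegral P W τ ε f) (obsLaw (fun _ ↦ 1) (fun j ↦ √(∫ x in bin n j, f x)) τ) P := by
  have hX : ∀ k ≤ n, IsWienerIntegral W P (fun x ↦ √(f x)) ((k : ℝ≥0) / n)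
      (wienerIntegral W P (fun x ↦ √(f x)) ((k : ℝ≥0) / n)) := fun k hk ↦ by
    refine isWienerIntegral_wienerIntegral hW (hf.sqrt.mono (Icc_subset_Icc_right ?_))
    exact div_le_one_of_le₀ (by exact_mod_cast hk) (NNReal.coe_nonneg _)
  have hs : ∀ j : Fin n, √(∫ x in bin n j, f x) ^ 2 = ∫ x in bin n j, √(f x) ^ 2 := fun j ↦ by
    rw [Real.sq_sqrt (hf_pos j).le]
    exact setIntegral_congr_fun (measurableSet_bin n j) fun x hx ↦
      (Real.sq_sqrt (hf_nonneg x (bin_subset_Icc j hx))).symm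
  have hlaw := hasLaw_obsLaw hW hf.sqrt hX (fun j ↦ (Real.sqrt_pos.2 (hf_pos j)).ne') hs hε hindep
    hWε (fun _ ↦ 1) τ
  refine hlaw.congr (ae_of_all _ fun ω ↦ ?_)
  ext i
  simp only [obsIntegral, obsTime_eq, one_mul]

theorem hasLaw_obsProduct (hW : IsPreBrownianReal W P) {n : ℕ} (f : ℝ → ℝ) {ε : Fin n → Ω → ℝ}
    (hε : ∀ i, HasLaw (ε i) (gaussianReal 0 1) P) (hindep : iIndepFun ε P)
    (hWε : IndepFun (fun ω t ↦ W t ω) (fun ω i ↦ ε i ω) P) (τ : ℝ) :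
    HasLaw (obsProduct W τ ε f) (obsLaw (fun i ↦ √(f (obsTime i))) (fun _ ↦ √(1 / n)) τ) P := by
  have hs_ne : ∀ _ : Fin n, √(1 / n : ℝ) ≠ 0 := fun j ↦
    (Real.sqrt_pos.2 (one_div_pos.2 (Nat.cast_pos.2 j.pos))).ne'
  have hlaw := hasLaw_obsLaw hW (g := fun _ ↦ 1) continuousOn_const
    (X := fun k : ℕ ↦ W ((k : ℝ≥0) / n)) (fun k _ ↦ isWienerIntegral_one hW _) hs_ne
    (fun j ↦ by simp [volume_real_bin]) hε hindep hWε (fun i ↦ √(f (obsTime i))) τ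
  refine hlaw.congr (ae_of_all _ fun ω ↦ ?_)
  ext i
  simp only [obsProduct, obsTime_eq]

end ObsLaw

/-! ### A unimodular change of variables between two observation laws -/

/-- The ramp `k ↦ min k K / K`, which increases from `0` to `1` on `[0, K]`. -/
def ramp (K k : ℕ) : ℝ := (min k K : ℕ) / K

theorem ramp_zero_right (K : ℕ) : ramp K 0 = 0 := by simp [ramp]

theorem ramp_mem_Icc (K k : ℕ) : ramp K k ∈ Icc 0 1 :=
  ⟨by unfold ramp; positivity,
    div_le_one_of_le₀ (by exact_mod_cast min_le_right k K) K.cast_nonneg⟩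

theorem ramp_of_le {K k : ℕ} (hK : K ≠ 0) (h : K ≤ k) : ramp K k = 1 := by
  rw [ramp, min_eq_right h, div_self (Nat.cast_ne_zero.2 hK)]

theorem ramp_sub_ramp {K : ℕ} (hK : K ≠ 0) (p j : ℕ) :
    ramp K (p - j) - ramp K (p - 1 - j) = if j + 1 ≤ p ∧ p < j + 1 + K then (K : ℝ)⁻¹ else 0 := by
  have hK' : (K : ℝ) ≠ 0 := Nat.cast_ne_zero.2 hK
  split_ifs with h
  · have hp : min (p - j) K = p - j := by lia
    have hp' : min (p - 1 - j) K = p - j - 1 := by lia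
    rw [ramp, ramp, hp, hp', Nat.cast_sub (by lia : 1 ≤ p - j), Nat.cast_one]
    field_simp
    ring
  · have hmin : min (p - j) K = min (p - 1 - j) K := by lia
    rw [ramp, ramp, hmin, sub_self]

theorem card_filter_val_mem_Ico_le {n : ℕ} (a b : ℕ) :
    (Finset.univ.filter fun i : Fin n ↦ (i : ℕ) ∈ Finset.Ico a b).card ≤ b - a := by
  rw [← Nat.card_Ico]
  exact Finset.card_le_card_of_injOn Fin.val (fun i hi ↦ by simpa using hi)
    Fin.val_injective.injOn

theorem sum_band_le {n : ℕ} (K δ : ℕ) {u v : Fin n → ℝ} (hu : ∀ i, 0 ≤ u i) (hv : ∀ i, 0 ≤ v i) :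
    ∑ p : Fin n, ∑ j : Fin n, (if (j : ℕ) + δ ≤ p ∧ (p : ℕ) < j + δ + K then u p + v j else 0) ≤
      K * (∑ i, u i + ∑ i, v i) := by
  have hcol : ∀ p j : Fin n, (j : ℕ) + δ ≤ p ∧ (p : ℕ) < j + δ + K ↔
      (j : ℕ) ∈ Finset.Ico ((p : ℕ) + 1 - δ - K) ((p : ℕ) + 1 - δ) := fun p j ↦ by
    rw [Finset.mem_Ico]; lia
  have hrow : ∀ p j : Fin n, (j : ℕ) + δ ≤ p ∧ (p : ℕ) < j + δ + K ↔
      (p : ℕ) ∈ Finset.Ico ((j : ℕ) + δ) ((j : ℕ) + δ + K) := fun p j ↦ by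
    rw [Finset.mem_Ico]
  simp only [← Finset.sum_filter, Finset.sum_add_distrib, mul_add, Finset.mul_sum]
  refine add_le_add (Finset.sum_le_sum fun p _ ↦ ?_) ?_
  · rw [Finset.sum_const, nsmul_eq_mul]
    simp only [hcol]
    refine mul_le_mul_of_nonneg_right (Nat.cast_le.2 ?_) (hu p)
    exact (card_filter_val_mem_Ico_le _ _).trans (by lia)
  · simp only [Finset.sum_filter]
    rw [Finset.sum_comm]
    refine Finset.sum_le_sum fun j _ ↦ ?_
    rw [← Finset.sum_filter, Finset.sum_const, nsmul_eq_mul]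
    simp only [hrow]
    refine mul_le_mul_of_nonneg_right (Nat.cast_le.2 ?_) (hv j)
    exact (card_filter_val_mem_Ico_le _ _).trans (by lia)

section Transform

variable {n : ℕ} {K : ℕ} {a s a' s' : Fin n → ℝ} {τ : ℝ} {Q : ℕ → Fin n → ℝ} {p j : Fin n}

/-- The shift of the signal coordinates: `z_p` receives the contribution of the earlier `z_j` for
which the partial sum `∑_{p ≤ i} s_p z_p` changes by `∑_j Q i j * ramp K (i - j) * z_j`. The first
argument of `Q` is a natural number so that `Q (p - 1)` makes sense for `p = 0`, where its
coefficient vanishes. -/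
def signalShift (K : ℕ) (s : Fin n → ℝ) (Q : ℕ → Fin n → ℝ) : Matrix (Fin n) (Fin n) ℝ :=
  fun p j ↦ (s p)⁻¹ * (Q p j * ramp K (p - j) - Q (p - 1) j * ramp K (p - 1 - j))

/-- The shift of the noise coordinates, which carries the part `1 - ramp K (i - j)` of the
discrepancy that `signalShift` leaves. -/
def noiseShift (K : ℕ) (a : Fin n → ℝ) (τ : ℝ) (Q : ℕ → Fin n → ℝ) : Matrix (Fin n) (Fin n) ℝ :=
  fun i j ↦ if j ≤ i then τ⁻¹ * (a i * Q i j * (1 - ramp K (i - j))) else 0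

/-- The change of variables on `(z, e)` that turns the observation law with coefficients `a`, `s`
into one whose products of coefficients differ by `a_i * Q i j`. An increment at a lag of at least
`K` is corrected by shifting the signal, a recent one also by shifting the noise: either of the two
alone would displace the Gaussian measure too far. -/
def obsShift (K : ℕ) (a s : Fin n → ℝ) (τ : ℝ) (Q : ℕ → Fin n → ℝ) :
    Matrix (Fin n ⊕ Fin n) (Fin n ⊕ Fin n) ℝ :=
  Matrix.fromBlocks (1 + signalShift K s Q) 0 (noiseShift K a τ Q) 1

theorem signalShift_eq_zero (h : p ≤ j) : signalShift K s Q p j = 0 := by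
  rw [signalShift, (by lia : (p : ℕ) - j = 0), (by lia : (p : ℕ) - 1 - j = 0), ramp_zero_right]
  ring

theorem det_obsShift (K : ℕ) (a s : Fin n → ℝ) (τ : ℝ) (Q : ℕ → Fin n → ℝ) :
    (obsShift K a s τ Q).det = 1 := by
  rw [obsShift, Matrix.det_fromBlocks_zero₁₂, Matrix.det_one, mul_one,
    Matrix.det_of_isLowerTriangular]
  · simp [signalShift_eq_zero]
  · intro i j hij
    have h : i < j := hij
    simp [Matrix.one_apply_ne h.ne, signalShift_eq_zero h.le]

theorem one_add_signalShift_apply_sq (p j : Fin n) :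
    (1 + signalShift K s Q) p j ^ 2 = (if p = j then 1 else 0) + signalShift K s Q p j ^ 2 := by
  rcases eq_or_ne p j with rfl | h
  · simp [signalShift_eq_zero le_rfl]
  · simp [Matrix.one_apply_ne h, h]

theorem sum_sq_obsShift (K : ℕ) (a s : Fin n → ℝ) (τ : ℝ) (Q : ℕ → Fin n → ℝ) :
    ∑ i, ∑ j, obsShift K a s τ Q i j ^ 2 = Fintype.card (Fin n ⊕ Fin n) +
      (∑ i, ∑ j, signalShift K s Q i j ^ 2 + ∑ i, ∑ j, noiseShift K a τ Q i j ^ 2) := by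
  have hone : ∀ i j, (1 : Matrix (Fin n) (Fin n) ℝ) i j ^ 2 = if i = j then 1 else 0 := by
    intro i j
    rw [Matrix.one_apply]
    split_ifs <;> simp
  simp only [Fintype.sum_sum_type, obsShift, Matrix.fromBlocks_apply₁₁,
    Matrix.fromBlocks_apply₁₂, Matrix.fromBlocks_apply₂₁, Matrix.fromBlocks_apply₂₂,
    Matrix.zero_apply, one_add_signalShift_apply_sq, hone, Finset.sum_add_distrib,
    Finset.sum_ite_eq, Finset.mem_univ, if_true, Finset.sum_const, Finset.card_univ,
    Fintype.card_sum, Fintype.card_fin]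
  push_cast [nsmul_eq_mul]
  ring

theorem obsShift_mulVec_inl (x : Fin n ⊕ Fin n → ℝ) (p : Fin n) :
    (obsShift K a s τ Q).mulVec x (Sum.inl p) =
      x (Sum.inl p) + ∑ j, signalShift K s Q p j * x (Sum.inl j) := by
  simp [obsShift, Matrix.mulVec, dotProduct, Fintype.sum_sum_type, add_mul,
    Finset.sum_add_distrib, Matrix.one_apply]

theorem obsShift_mulVec_inr (x : Fin n ⊕ Fin n → ℝ) (i : Fin n) :
    (obsShift K a s τ Q).mulVec x (Sum.inr i) =
      ∑ j, noiseShift K a τ Q i j * x (Sum.inl j) + x (Sum.inr i) := by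
  simp [obsShift, Matrix.mulVec, dotProduct, Fintype.sum_sum_type, Matrix.one_apply]

theorem sum_Iic_mul_signalShift (hs : ∀ p, s p ≠ 0) (i j : Fin n) :
    ∑ p ∈ Finset.Iic i, s p * signalShift K s Q p j = Q i j * ramp K (i - j) := by
  have htel := sum_Iic_sub (fun k ↦ Q (k - 1) j * ramp K (k - 1 - j)) i
  simp only [Nat.add_sub_cancel, Nat.zero_sub, ramp_zero_right, mul_zero, sub_zero] at htel
  rw [← htel]
  exact Finset.sum_congr rfl fun p _ ↦ mul_inv_cancel_left₀ (hs p) _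

theorem add_mul_noiseShift (hτ : τ ≠ 0) (i j : Fin n) :
    a i * (Q i j * ramp K (i - j)) + τ * noiseShift K a τ Q i j =
      if j ≤ i then a i * Q i j else 0 := by
  unfold noiseShift
  split_ifs with h
  · field_simp; ring
  · rw [Nat.sub_eq_zero_of_le (le_of_not_ge h : i ≤ j), ramp_zero_right]; ring

theorem obsMap_obsShift_mulVec (hτ : τ ≠ 0) (hs : ∀ j, s j ≠ 0)
    (hQ : ∀ i j : Fin n, a' i * s' j - a i * s j = a i * Q i j) (x : Fin n ⊕ Fin n → ℝ) :
    obsMap a s τ ((obsShift K a s τ Q).mulVec x) = obsMap a' s' τ x := by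
  ext i
  have hsignal : ∑ p ∈ Finset.Iic i, s p * ∑ j, signalShift K s Q p j * x (Sum.inl j) =
      ∑ j, Q i j * ramp K (i - j) * x (Sum.inl j) := by
    simp only [← sum_Iic_mul_signalShift hs, Finset.mul_sum, Finset.sum_mul, mul_assoc]
    exact Finset.sum_comm
  have hcorrection : a i * ∑ j, Q i j * ramp K (i - j) * x (Sum.inl j) +
      τ * ∑ j, noiseShift K a τ Q i j * x (Sum.inl j) =
      ∑ j ∈ Finset.Iic i, a i * Q i j * x (Sum.inl j) := by
    simp only [Finset.mul_sum, ← Finset.sum_add_distrib, ← mul_assoc, ← add_mul]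
    rw [← Finset.filter_univ_mem (Finset.Iic i), Finset.sum_filter]
    refine Finset.sum_congr rfl fun j _ ↦ ?_
    rw [mul_assoc (a i), add_mul_noiseShift hτ, ite_mul, zero_mul]
    simp only [Finset.mem_Iic]
  calc obsMap a s τ ((obsShift K a s τ Q).mulVec x) i
      = a i * ∑ j ∈ Finset.Iic i, s j * x (Sum.inl j) +
          (a i * ∑ j, Q i j * ramp K (i - j) * x (Sum.inl j) +
            τ * ∑ j, noiseShift K a τ Q i j * x (Sum.inl j)) + τ * x (Sum.inr i) := by
        simp only [obsMap, obsShift_mulVec_inl, obsShift_mulVec_inr, mul_add,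
          Finset.sum_add_distrib, hsignal]
        ring
    _ = ∑ j ∈ Finset.Iic i, (a i * s j + a i * Q i j) * x (Sum.inl j) + τ * x (Sum.inr i) := by
        rw [hcorrection]
        simp only [Finset.mul_sum, ← mul_assoc, ← Finset.sum_add_distrib, ← add_mul]
    _ = obsMap a' s' τ x i := by
        simp only [← hQ, add_sub_cancel, obsMap, Finset.mul_sum, mul_assoc]

theorem signalShift_sq_le (hK : K ≠ 0) {v : ℝ} (hv : 0 < v) (hs : ∀ p, v ≤ s p ^ 2)
    {row col : Fin n → ℝ} (hQ : ∀ p j : Fin n, Q p j ^ 2 ≤ row p + col j) (p j : Fin n) :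
    signalShift K s Q p j ^ 2 ≤ 2 / v *
      (((K : ℝ)⁻¹) ^ 2 *
          (if (j : ℕ) + 1 ≤ p ∧ (p : ℕ) < j + 1 + K then row p + col j else 0) +
        (Q p j - Q (p - 1) j) ^ 2) := by
  set w' := ramp K (p - 1 - j)
  set Δ := ramp K (p - j) - w' with hΔ
  obtain ⟨hw'_nonneg, hw'_le_one⟩ : w' ∈ Icc 0 1 := ramp_mem_Icc K _
  have hband : (Q p j * Δ) ^ 2 ≤ ((K : ℝ)⁻¹) ^ 2 *
      (if (j : ℕ) + 1 ≤ p ∧ (p : ℕ) < j + 1 + K then row p + col j else 0) := by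
    rw [hΔ, ramp_sub_ramp hK]
    split_ifs
    · rw [mul_pow, mul_comm]
      exact mul_le_mul_of_nonneg_left (hQ p j) (sq_nonneg _)
    · simp
  have hvar : ((Q p j - Q (p - 1) j) * w') ^ 2 ≤ (Q p j - Q (p - 1) j) ^ 2 := by
    rw [mul_pow]
    exact mul_le_of_le_one_right (sq_nonneg _) (pow_le_one₀ hw'_nonneg hw'_le_one)
  calc signalShift K s Q p j ^ 2
      = (s p ^ 2)⁻¹ * (Q p j * Δ + (Q p j - Q (p - 1) j) * w') ^ 2 := by
        rw [signalShift, mul_pow, inv_pow]; ring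
    _ ≤ v⁻¹ * (2 * ((Q p j * Δ) ^ 2 + ((Q p j - Q (p - 1) j) * w') ^ 2)) :=
        mul_le_mul (inv_anti₀ hv (hs p)) add_sq_le (sq_nonneg _) (inv_nonneg.2 hv.le)
    _ ≤ v⁻¹ * (2 * (((K : ℝ)⁻¹) ^ 2 *
          (if (j : ℕ) + 1 ≤ p ∧ (p : ℕ) < j + 1 + K then row p + col j else 0) +
        (Q p j - Q (p - 1) j) ^ 2)) := by gcongr
    _ = _ := by ring

theorem sum_sq_signalShift_le (hK : K ≠ 0) {v : ℝ} (hv : 0 < v) (hs : ∀ p, v ≤ s p ^ 2)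
    {row col : Fin n → ℝ} (hrow : ∀ i, 0 ≤ row i) (hcol : ∀ i, 0 ≤ col i)
    (hQ : ∀ p j : Fin n, Q p j ^ 2 ≤ row p + col j) :
    ∑ i, ∑ j, signalShift K s Q i j ^ 2 ≤ 2 / v * ((∑ i, row i + ∑ i, col i) / K +
      ∑ p : Fin n, ∑ j, (Q p j - Q (p - 1) j) ^ 2) := by
  have hK' : (K : ℝ) ≠ 0 := Nat.cast_ne_zero.2 hK
  refine (Finset.sum_le_sum fun p _ ↦ Finset.sum_le_sum fun j _ ↦
    signalShift_sq_le hK hv hs hQ p j).trans ?_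
  simp only [← Finset.mul_sum, Finset.sum_add_distrib]
  refine mul_le_mul_of_nonneg_left (add_le_add ?_ le_rfl) (by positivity)
  calc ((K : ℝ)⁻¹) ^ 2 * _ ≤ ((K : ℝ)⁻¹) ^ 2 * (K * (∑ i, row i + ∑ i, col i)) :=
        mul_le_mul_of_nonneg_left (sum_band_le K 1 hrow hcol) (sq_nonneg _)
    _ = (∑ i, row i + ∑ i, col i) / K := by field_simp

theorem noiseShift_sq_le (hK : K ≠ 0) {A : ℝ} (ha : ∀ i, a i ^ 2 ≤ A) {row col : Fin n → ℝ}
    (hQ : ∀ p j : Fin n, Q p j ^ 2 ≤ row p + col j) (i j : Fin n) :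
    noiseShift K a τ Q i j ^ 2 ≤ A / τ ^ 2 *
      (if (j : ℕ) + 0 ≤ i ∧ (i : ℕ) < j + 0 + K then row i + col j else 0) := by
  rw [noiseShift]
  split_ifs with hji hband hband
  · obtain ⟨hw_nonneg, hw_le_one⟩ : ramp K (i - j) ∈ Icc 0 1 := ramp_mem_Icc K _
    have hA : 0 ≤ A := (sq_nonneg _).trans (ha i)
    have hw : (1 - ramp K (i - j)) ^ 2 ≤ 1 := pow_le_one₀ (by linarith) (by linarith)
    calc (τ⁻¹ * (a i * Q i j * (1 - ramp K (i - j)))) ^ 2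
        = (τ ^ 2)⁻¹ * (a i ^ 2 * Q i j ^ 2 * (1 - ramp K (i - j)) ^ 2) := by
          rw [mul_pow, mul_pow, mul_pow, inv_pow]
      _ ≤ (τ ^ 2)⁻¹ * (A * (row i + col j) * 1) := by
          have hQ_nonneg := (sq_nonneg (Q i j)).trans (hQ i j)
          gcongr
          · exact ha i
          · exact hQ i j
      _ = A / τ ^ 2 * (row i + col j) := by ring
  · have hlag : K ≤ (i : ℕ) - j := by
      have : (j : ℕ) ≤ i := hji
      lia
    simp [ramp_of_le hK hlag]
  · exact absurd (by simpa using hband.1) hji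
  · simp

theorem sum_sq_noiseShift_le (hK : K ≠ 0) {A : ℝ} (hA : 0 ≤ A) (ha : ∀ i, a i ^ 2 ≤ A)
    {row col : Fin n → ℝ} (hrow : ∀ i, 0 ≤ row i) (hcol : ∀ i, 0 ≤ col i)
    (hQ : ∀ p j : Fin n, Q p j ^ 2 ≤ row p + col j) :
    ∑ i, ∑ j, noiseShift K a τ Q i j ^ 2 ≤ A / τ ^ 2 * (K * (∑ i, row i + ∑ i, col i)) := by
  refine (Finset.sum_le_sum fun p _ ↦ Finset.sum_le_sum fun j _ ↦
    noiseShift_sq_le hK ha hQ p j).trans ?_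
  simp only [← Finset.mul_sum]
  exact mul_le_mul_of_nonneg_left (sum_band_le K 0 hrow hcol) (by positivity)

theorem quarter_le_inf_obsLaw_univ (hK : K ≠ 0) (hτ : τ ≠ 0)
    (hQ_eq : ∀ i j : Fin n, a' i * s' j - a i * s j = a i * Q i j) {v A : ℝ} (hv : 0 < v)
    (hs : ∀ p, v ≤ s p ^ 2) (hA : 0 ≤ A) (ha : ∀ i, a i ^ 2 ≤ A) {row col : Fin n → ℝ}
    (hrow : ∀ i, 0 ≤ row i) (hcol : ∀ i, 0 ≤ col i)
    (hQ : ∀ p j : Fin n, Q p j ^ 2 ≤ row p + col j)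
    (hsum : 2 / v * ((∑ i, row i + ∑ i, col i) / K +
      ∑ p : Fin n, ∑ j, (Q p j - Q (p - 1) j) ^ 2) +
      A / τ ^ 2 * (K * (∑ i, row i + ∑ i, col i)) ≤ 1) :
    ENNReal.ofReal (1 / 4) ≤ (obsLaw a s τ ⊓ obsLaw a' s' τ) univ := by
  have hs_ne : ∀ j, s j ≠ 0 := fun j ↦ pow_ne_zero_iff two_ne_zero |>.1 (hv.trans_le (hs j)).ne'
  have hshift : obsLaw a' s' τ =
      ((stdGaussianPi _).map (obsShift K a s τ Q).mulVec).map (obsMap a s τ) := by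
    rw [Measure.map_map (measurable_obsMap a s τ) (measurable_mulVec _), obsLaw]
    exact congrArg (Measure.map · _)
      (funext fun x ↦ (obsMap_obsShift_mulVec hτ hs_ne hQ_eq x).symm)
  have hsum_sq : ∑ i, ∑ j, obsShift K a s τ Q i j ^ 2 ≤ Fintype.card (Fin n ⊕ Fin n) + 1 := by
    have hsignal := sum_sq_signalShift_le hK hv hs hrow hcol hQ
    have hnoise := sum_sq_noiseShift_le (τ := τ) hK hA ha hrow hcol hQ
    rw [sum_sq_obsShift]
    linarith
  rw [hshift]
  exact (quarter_le_inf_map_mulVec_univ (det_obsShift K a s τ Q) hsum_sq).trans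
    (inf_univ_le_inf_map_univ (measurable_obsMap a s τ))

end Transform

/-! ### Sums of translates -/

theorem support_iteratedDeriv_subset (f : ℝ → ℝ) (k : ℕ) :
    Function.support (iteratedDeriv k f) ⊆ tsupport f := fun x hx ↦ by
  refine support_iteratedFDeriv_subset (𝕜 := ℝ) k ?_
  rwa [Function.mem_support, ← norm_ne_zero_iff, norm_iteratedFDeriv_eq_norm_iteratedDeriv,
    norm_ne_zero_iff]

theorem exists_bound_iteratedDeriv {f : ℝ → ℝ} {k : ℕ} (hf : ContDiff ℝ k f)
    (hf_supp : HasCompactSupport f) : ∃ M, ∀ x, |iteratedDeriv k f x| ≤ M :=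
  (hf.continuous_iteratedDeriv k le_rfl).bounded_above_of_compact_support
    (hf_supp.mono' (support_iteratedDeriv_subset f k))

theorem abs_sub_le_mul_rpow {g : ℝ → ℝ} {N M b : ℝ} (hN : ∀ x, |g x| ≤ N)
    (hM : ∀ x y, |g x - g y| ≤ M * |x - y|) (hb : b ∈ Icc (0 : ℝ) 1) (x y : ℝ) :
    |g x - g y| ≤ (2 * N + M) * |x - y| ^ b := by
  have hN_nonneg : 0 ≤ N := (abs_nonneg _).trans (hN 0)
  have hM_nonneg : 0 ≤ M := by simpa using (abs_nonneg _).trans (hM 1 0)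
  rcases le_total |x - y| 1 with h | h
  · calc |g x - g y| ≤ M * |x - y| := hM x y
      _ ≤ (2 * N + M) * |x - y| ^ b := by
        gcongr
        · linarith
        · exact Real.self_le_rpow_of_le_one (abs_nonneg _) h hb.2
  · calc |g x - g y| ≤ 2 * N * 1 := by linarith [abs_sub (g x) (g y), hN x, hN y]
      _ ≤ (2 * N + M) * |x - y| ^ b := by
        gcongr
        · linarith
        · exact Real.one_le_rpow h hb.1

/-- The linear combination of the translates of `F` by `0, …, m - 1` with coefficients `c`. -/
def translateSum {m : ℕ} (c : Fin m → ℝ) (F : ℝ → ℝ) (y : ℝ) : ℝ := ∑ j : Fin m, c j * F (y - j)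

section TranslateSum

variable {m : ℕ} {c : Fin m → ℝ} {F : ℝ → ℝ}

theorem translateSum_eq_single (hF : Function.support F ⊆ Ioo 0 1) {y : ℝ} {k : Fin m}
    (hk : y - k ∈ Ioo (0 : ℝ) 1) : translateSum c F y = c k * F (y - k) := by
  refine Finset.sum_eq_single k (fun j _ hj ↦ ?_) (by simp)
  by_contra h
  have hj_mem := hF (right_ne_zero_of_mul h)
  have hjk : (j : ℝ) < k + 1 := by linarith [hj_mem.1, hk.2]
  have hkj : (k : ℝ) < j + 1 := by linarith [hj_mem.2, hk.1]
  norm_cast at hjk hkj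
  exact hj (Fin.ext (by lia))

theorem abs_translateSum_le (hc : ∀ k, |c k| ≤ 1) (hF : Function.support F ⊆ Ioo 0 1) {M : ℝ}
    (hM : ∀ x, |F x| ≤ M) (y : ℝ) : |translateSum c F y| ≤ M := by
  by_cases h : ∃ k : Fin m, y - k ∈ Ioo (0 : ℝ) 1
  · obtain ⟨k, hk⟩ := h
    rw [translateSum_eq_single hF hk, abs_mul]
    exact (mul_le_of_le_one_left (abs_nonneg _) (hc k)).trans (hM _)
  · push Not at h
    rw [translateSum, Finset.sum_eq_zero fun j _ ↦ by
      rw [Function.notMem_support.1 fun hj ↦ h j (hF hj), mul_zero], abs_zero]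
    exact (abs_nonneg _).trans (hM 0)

theorem contDiff_translateSum {k : WithTop ℕ∞} (hF : ContDiff ℝ k F) (c : Fin m → ℝ) :
    ContDiff ℝ k (translateSum c F) :=
  ContDiff.sum fun _ _ ↦ contDiff_const.mul (hF.comp (contDiff_id.sub contDiff_const))

theorem iteratedDeriv_translateSum {k : ℕ} (hF : ContDiff ℝ k F) (c : Fin m → ℝ) :
    iteratedDeriv k (translateSum c F) = translateSum c (iteratedDeriv k F) := by
  have htrans : ∀ j : Fin m, ContDiff ℝ k fun y : ℝ ↦ F (y - j) := fun j ↦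
    hF.comp (contDiff_id.sub contDiff_const)
  ext y
  unfold translateSum
  rw [iteratedDeriv_fun_sum fun j _ ↦ (contDiff_const.mul (htrans j)).contDiffAt]
  refine Finset.sum_congr rfl fun j _ ↦ ?_
  rw [iteratedDeriv_const_mul _ (htrans j).contDiffAt, iteratedDeriv_comp_sub_const]

theorem exists_holder_iteratedDeriv_translateSum {k : ℕ} (hF : ContDiff ℝ (k + 1 : ℕ) F)
    (hF_supp : tsupport F ⊆ Ioo 0 1) :
    ∃ H, 0 ≤ H ∧ ∀ {m : ℕ} (c : Fin m → ℝ), (∀ j, |c j| ≤ 1) → ∀ b ∈ Icc (0 : ℝ) 1, ∀ x y,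
      |iteratedDeriv k (translateSum c F) x - iteratedDeriv k (translateSum c F) y| ≤
        H * |x - y| ^ b := by
  have hF_compact : HasCompactSupport F :=
    isCompact_Icc.of_isClosed_subset (isClosed_tsupport F) (hF_supp.trans Ioo_subset_Icc_self)
  have hFk : ContDiff ℝ k F := hF.of_le (by exact_mod_cast k.le_succ)
  obtain ⟨N, hN⟩ := exists_bound_iteratedDeriv hFk hF_compact
  obtain ⟨M, hM⟩ := exists_bound_iteratedDeriv hF hF_compact
  have hsupp : ∀ i, Function.support (iteratedDeriv i F) ⊆ Ioo 0 1 := fun i ↦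
    (support_iteratedDeriv_subset F i).trans hF_supp
  have hM_nonneg : 0 ≤ M := (abs_nonneg _).trans (hM 0)
  have hN_nonneg : 0 ≤ N := (abs_nonneg _).trans (hN 0)
  refine ⟨2 * N + M, by positivity, fun c hc b hb ↦ abs_sub_le_mul_rpow (fun x ↦ ?_) ?_ hb⟩
  · rw [iteratedDeriv_translateSum hFk]
    exact abs_translateSum_le hc (hsupp k) hN x
  · intro x y
    have hdiff : Differentiable ℝ (iteratedDeriv k (translateSum c F)) :=
      (contDiff_translateSum hF c).differentiable_iteratedDeriv k (by exact_mod_cast k.lt_succ_self)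
    refine convex_univ.norm_image_sub_le_of_norm_deriv_le (fun z _ ↦ hdiff z) (fun z _ ↦ ?_)
      (mem_univ y) (mem_univ x)
    rw [← iteratedDeriv_succ, iteratedDeriv_translateSum hF]
    exact abs_translateSum_le hc (hsupp (k + 1)) hM z

end TranslateSum

/-! ### The hypercube of perturbed functions -/

/-- A smooth bump with support in `(0, 1)` which is equal to `1` on the middle half. -/
def unitBump : ContDiffBump (1 / 2 : ℝ) where
  rIn := 1 / 4
  rOut := 3 / 8
  rIn_pos := by norm_num
  rIn_lt_rOut := by norm_num

theorem tsupport_unitBump_subset : tsupport unitBump ⊆ Ioo 0 1 := by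
  rw [unitBump.tsupport_eq, Real.closedBall_eq_Icc]
  exact Icc_subset_Ioo (by norm_num [unitBump]) (by norm_num [unitBump])

theorem support_unitBump_subset : Function.support unitBump ⊆ Ioo 0 1 :=
  (subset_tsupport _).trans tsupport_unitBump_subset

theorem unitBump_eq_one {x : ℝ} (hx : x ∈ Icc (1 / 4 : ℝ) (3 / 4)) : unitBump x = 1 := by
  refine unitBump.one_of_mem_closedBall ?_
  rw [Real.closedBall_eq_Icc]
  norm_num [unitBump] at hx ⊢
  exact hx

/-- The bump of height `A` on the interval `(k / m, (k + 1) / m)`. -/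
def cubeBump (A : ℝ) (m k : ℕ) (t : ℝ) : ℝ := A * unitBump (m * t - k)

/-- The vertex `θ` of the hypercube: `l` plus bumps of height `A` on the intervals
`(k / m, (k + 1) / m)` with `θ k = true`. -/
def cubeFun (l A : ℝ) {m : ℕ} (θ : Fin m → Bool) (t : ℝ) : ℝ :=
  l + A * translateSum (fun k ↦ if θ k then 1 else 0) unitBump (m * t)

theorem contDiff_cubeBump (A : ℝ) (m k : ℕ) (i : ℕ∞) : ContDiff ℝ i (cubeBump A m k) :=
  contDiff_const.mul (unitBump.contDiff.comp ((contDiff_const.mul contDiff_id).sub contDiff_const))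

theorem cubeBump_eq_zero {A : ℝ} {m k : ℕ} {t : ℝ} (ht : (m : ℝ) * t - k ∉ Ioo (0 : ℝ) 1) :
    cubeBump A m k t = 0 := by
  rw [cubeBump, Function.notMem_support.1 (mt (support_unitBump_subset ·) ht), mul_zero]

theorem cubeBump_nonneg {A : ℝ} (hA : 0 ≤ A) (m k : ℕ) (t : ℝ) : 0 ≤ cubeBump A m k t :=
  mul_nonneg hA unitBump.nonneg

theorem cubeBump_le {A : ℝ} (hA : 0 ≤ A) (m k : ℕ) (t : ℝ) : cubeBump A m k t ≤ A :=
  mul_le_of_le_one_right hA unitBump.le_one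

theorem exists_lipschitz_cubeBump : ∃ M, ∀ A, 0 ≤ A → ∀ (m k : ℕ) (x y : ℝ),
    |cubeBump A m k x - cubeBump A m k y| ≤ A * m * M * |x - y| := by
  obtain ⟨M, hM⟩ := unitBump.contDiff.lipschitzWith_of_hasCompactSupport
    unitBump.hasCompactSupport (n := 1) one_ne_zero
  refine ⟨M, fun A hA m k x y ↦ ?_⟩
  calc |cubeBump A m k x - cubeBump A m k y|
      = A * dist (unitBump (m * x - k)) (unitBump (m * y - k)) := by
        rw [cubeBump, cubeBump, ← mul_sub, abs_mul, abs_of_nonneg hA, Real.dist_eq]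
    _ ≤ A * (M * dist ((m : ℝ) * x - k) (m * y - k)) := by gcongr; exact hM.dist_le_mul _ _
    _ = A * m * M * |x - y| := by
        rw [dist_sub_right, Real.dist_eq, ← mul_sub, abs_mul, Nat.abs_cast]; ring

theorem ofReal_le_lintegral_cubeBump_sq {m : ℕ} (hm : 0 < m) (A : ℝ) (k : ℕ) :
    ENNReal.ofReal (A ^ 2 / (2 * m)) ≤
      ∫⁻ t in bin m k, ENNReal.ofReal (cubeBump A m k t ^ 2) := by
  have hm' : (0 : ℝ) < m := Nat.cast_pos.2 hm
  set middle : Set ℝ := Ioc ((k + 1 / 4 : ℝ) / m) ((k + 3 / 4) / m)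
  have hmiddle : middle ⊆ bin m k :=
    Ioc_subset_Ioc (by gcongr; linarith) (by gcongr; linarith)
  have hbump : ∀ t ∈ middle, cubeBump A m k t = A := fun t ht ↦ by
    have hlo := (div_lt_iff₀' hm').1 ht.1
    have hhi := (le_div_iff₀' hm').1 ht.2
    rw [cubeBump, unitBump_eq_one ⟨by linarith, by linarith⟩, mul_one]
  calc ENNReal.ofReal (A ^ 2 / (2 * m))
      = ENNReal.ofReal (A ^ 2) * volume middle := by
        rw [Real.volume_Ioc, ← ENNReal.ofReal_mul (sq_nonneg A)]
        congr 1
        field_simp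
        ring
    _ = ∫⁻ t in middle, ENNReal.ofReal (cubeBump A m k t ^ 2) := by
        rw [← setLIntegral_const]
        exact setLIntegral_congr_fun measurableSet_Ioc fun t ht ↦ by rw [hbump t ht]
    _ ≤ ∫⁻ t in bin m k, ENNReal.ofReal (cubeBump A m k t ^ 2) := lintegral_mono_set hmiddle

section CubeFun

variable {l A : ℝ} {m : ℕ} {θ : Fin m → Bool} {k : Fin m}

theorem abs_ite_one_zero_le (θ : Fin m → Bool) (k : Fin m) :
    |if θ k then (1 : ℝ) else 0| ≤ 1 := by
  split_ifs <;> simp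

theorem contDiff_cubeFun (l A : ℝ) (θ : Fin m → Bool) (i : ℕ∞) : ContDiff ℝ i (cubeFun l A θ) :=
  contDiff_const.add (contDiff_const.mul
    ((contDiff_translateSum unitBump.contDiff _).comp (contDiff_const.mul contDiff_id)))

theorem le_cubeFun (hA : 0 ≤ A) (θ : Fin m → Bool) (t : ℝ) : l ≤ cubeFun l A θ t := by
  refine le_add_of_nonneg_right (mul_nonneg hA (Finset.sum_nonneg fun k _ ↦ ?_))
  exact mul_nonneg (ite_nonneg zero_le_one le_rfl) unitBump.nonneg

theorem cubeFun_le (hA : 0 ≤ A) (θ : Fin m → Bool) (t : ℝ) : cubeFun l A θ t ≤ l + A := by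
  have hsum := abs_translateSum_le (abs_ite_one_zero_le θ) support_unitBump_subset (M := 1)
    (fun x ↦ (abs_of_nonneg unitBump.nonneg).trans_le unitBump.le_one) (m * t)
  exact add_le_add_right (mul_le_of_le_one_right hA ((le_abs_self _).trans hsum)) l

theorem iteratedDeriv_cubeFun_sub (l A : ℝ) (θ : Fin m → Bool) (i : ℕ) (x y : ℝ) :
    iteratedDeriv i (cubeFun l A θ) x - iteratedDeriv i (cubeFun l A θ) y =
      A * (m : ℝ) ^ i *
        (iteratedDeriv i (translateSum (fun k ↦ if θ k then 1 else 0) unitBump) (m * x) -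
          iteratedDeriv i (translateSum (fun k ↦ if θ k then 1 else 0) unitBump) (m * y)) := by
  set g := translateSum (fun k ↦ if θ k then 1 else 0) unitBump
  have hg : ContDiff ℝ i g := contDiff_translateSum unitBump.contDiff _
  have hscale : ∀ z, iteratedDeriv i (fun t ↦ A * g (m * t)) z =
      A * (m : ℝ) ^ i * iteratedDeriv i g (m * z) := fun z ↦ by
    have hg_comp : ContDiff ℝ i fun t : ℝ ↦ g (m * t) :=
      hg.comp (contDiff_const.mul contDiff_id)
    rw [iteratedDeriv_const_mul _ hg_comp.contDiffAt, iteratedDeriv_comp_const_mul hg, mul_assoc]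
  rw [mul_sub, ← hscale, ← hscale]
  rcases Nat.eq_zero_or_pos i with rfl | hi
  · simp only [iteratedDeriv_zero]
    exact add_sub_add_left_eq_sub _ _ _
  · unfold cubeFun
    rw [iteratedDeriv_const_add hi, iteratedDeriv_const_add hi]

theorem cubeFun_update (hk : θ k = false) (t : ℝ) :
    cubeFun l A (Function.update θ k true) t = cubeFun l A θ t + cubeBump A m k t := by
  have hsum : translateSum (fun j ↦ if Function.update θ k true j then 1 else 0) unitBump (m * t) =
      translateSum (fun j ↦ if θ j then 1 else 0) unitBump (m * t) + unitBump (m * t - k) := by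
    rw [← sub_eq_iff_eq_add', translateSum, translateSum, ← Finset.sum_sub_distrib,
      Finset.sum_eq_single k (fun j _ hj ↦ by rw [Function.update_of_ne hj, sub_self]) (by simp)]
    simp [hk]
  rw [cubeFun, hsum, cubeFun, cubeBump]
  ring

theorem cubeFun_eq_of_mem (hk : θ k = false) {t : ℝ} (ht : (m : ℝ) * t - k ∈ Ioo (0 : ℝ) 1) :
    cubeFun l A θ t = l := by
  simp [cubeFun, translateSum_eq_single support_unitBump_subset ht, hk]

theorem exists_cubeFun_mem_boundedHolder {α L l u : ℝ} (hα : 0 ≤ α) (hL : 0 < L) (hlu : l < u) :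
    ∃ c > 0, ∀ {m : ℕ} {A : ℝ}, 0 < m → 0 ≤ A → A * (m : ℝ) ^ α ≤ c → ∀ θ : Fin m → Bool,
      cubeFun l A θ ∈ boundedHolder α L l u := by
  obtain ⟨H, hH_nonneg, hH⟩ := exists_holder_iteratedDeriv_translateSum (k := ⌊α⌋₊)
    unitBump.contDiff tsupport_unitBump_subset
  refine ⟨min (L / (H + 1)) (u - l), lt_min (by positivity) (sub_pos.2 hlu), ?_⟩
  intro m A hm hA hAm θ
  have hm' : (0 : ℝ) < m := Nat.cast_pos.2 hm
  have hA_le : A ≤ u - l := (le_mul_of_one_le_right hA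
    (Real.one_le_rpow (Nat.one_le_cast.2 hm) hα)).trans (hAm.trans (min_le_right _ _))
  have hscale : A * (m : ℝ) ^ ⌊α⌋₊ * (m : ℝ) ^ (α - (⌊α⌋₊ : ℝ)) * H ≤ L := by
    rw [mul_assoc A, ← Real.rpow_natCast, ← Real.rpow_add hm', add_sub_cancel]
    calc A * (m : ℝ) ^ α * H ≤ L / (H + 1) * (H + 1) := by
          gcongr
          · exact hAm.trans (min_le_left _ _)
          · linarith
      _ = L := div_mul_cancel₀ L (by positivity)
  have hU : UniqueDiffOn ℝ (Icc (0 : ℝ) 1) := uniqueDiffOn_Icc zero_lt_one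
  refine ⟨fun i _ ↦ ?_, fun x hx y hy ↦ ?_, fun x _ ↦ ⟨le_cubeFun hA θ x, ?_⟩⟩
  · exact (contDiff_cubeFun l A θ (i + 1 : ℕ)).contDiffOn.differentiableOn_iteratedDerivWithin
      (by exact_mod_cast i.lt_succ_self) hU
  · have hdiff := (contDiff_cubeFun l A θ ⌊α⌋₊).contDiffAt (x := x)
    have hdiff' := (contDiff_cubeFun l A θ ⌊α⌋₊).contDiffAt (x := y)
    rw [iteratedDerivWithin_eq_iteratedDeriv hU hdiff hx,
      iteratedDerivWithin_eq_iteratedDeriv hU hdiff' hy, iteratedDeriv_cubeFun_sub, abs_mul,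
      abs_of_nonneg (by positivity)]
    have hexp : α - (⌊α⌋₊ : ℝ) ∈ Icc (0 : ℝ) 1 :=
      ⟨sub_nonneg.2 (Nat.floor_le hα), by linarith [Nat.lt_floor_add_one α]⟩
    refine (mul_le_mul_of_nonneg_left (hH _ (abs_ite_one_zero_le θ) _ hexp (m * x) (m * y))
      (by positivity)).trans ?_
    rw [← mul_sub, abs_mul, Nat.abs_cast, Real.mul_rpow hm'.le (abs_nonneg _)]
    calc _ = A * (m : ℝ) ^ ⌊α⌋₊ * (m : ℝ) ^ (α - (⌊α⌋₊ : ℝ)) * H * |x - y| ^ (α - ⌊α⌋₊) := by ring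
      _ ≤ L * |x - y| ^ (α - ⌊α⌋₊) := by gcongr
  · linarith [cubeFun_le (l := l) hA θ x]

end CubeFun

/-! ### Neighbouring vertices of the hypercube -/

open Classical in
/-- The indices `j` for which the interval `[j / n, (j + 1) / n]` meets the support
`(k / m, (k + 1) / m)` of the `k`-th bump. -/
def blockIndices (n m k : ℕ) : Finset (Fin n) :=
  {j | (k : ℝ) * n < m * (j + 1) ∧ (m : ℝ) * j < (k + 1) * n}

theorem card_blockIndices_le {n m : ℕ} (hm : 0 < m) (hmn : m ≤ n) (k : ℕ) :
    ((blockIndices n m k).card : ℝ) ≤ 3 * n / m := by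
  have hm' : (0 : ℝ) < m := Nat.cast_pos.2 hm
  set lo : ℝ := k * n / m with hlo
  set hi : ℝ := (k + 1) * n / m with hhi
  have hlength : hi - lo = n / m := by rw [hlo, hhi]; ring
  have hlength_ge : 1 ≤ (n : ℝ) / m := by rwa [one_le_div hm', Nat.cast_le]
  have hsub : (blockIndices n m k).map Fin.valEmbedding ⊆ Finset.Ico ⌊lo⌋₊ ⌈hi⌉₊ := by
    intro x hx
    obtain ⟨j, hj, rfl⟩ := Finset.mem_map.1 hx
    obtain ⟨hj_lo, hj_hi⟩ := (Finset.mem_filter.1 hj).2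
    rw [Finset.mem_Ico, Fin.valEmbedding_apply, ← Nat.lt_succ_iff, Nat.floor_lt (by positivity),
      Nat.lt_ceil, hlo, hhi, div_lt_iff₀ hm', lt_div_iff₀ hm', Nat.cast_succ]
    exact ⟨by linarith, by linarith⟩
  have hcard := Finset.card_le_card hsub
  rw [Finset.card_map, Nat.card_Ico] at hcard
  have hfloor_le : ⌊lo⌋₊ ≤ ⌈hi⌉₊ :=
    (Nat.floor_le_ceil lo).trans (Nat.ceil_le_ceil (by linarith))
  calc ((blockIndices n m k).card : ℝ) ≤ (⌈hi⌉₊ - ⌊lo⌋₊ : ℕ) := Nat.cast_le.2 hcard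
    _ = ⌈hi⌉₊ - ⌊lo⌋₊ := Nat.cast_sub hfloor_le
    _ ≤ (hi + 1) - (lo - 1) :=
        sub_le_sub (Nat.ceil_lt_add_one (by positivity)).le (Nat.sub_one_lt_floor lo).le
    _ = n / m + 2 * 1 := by rw [← hlength]; ring
    _ ≤ n / m + 2 * (n / m) := by gcongr
    _ = 3 * n / m := by ring

theorem sum_le_of_eq_zero_off_blockIndices {n m : ℕ} (hm : 0 < m) (hmn : m ≤ n) (k : ℕ)
    {v : Fin n → ℝ} {V : ℝ} (hV : 0 ≤ V) (hv_zero : ∀ j ∉ blockIndices n m k, v j = 0)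
    (hv : ∀ j, v j ≤ V) : ∑ j, v j ≤ 3 * n / m * V := by
  rw [← Finset.sum_subset (Finset.subset_univ (blockIndices n m k)) fun j _ ↦ hv_zero j]
  refine (Finset.sum_le_card_nsmul _ _ V fun j _ ↦ hv j).trans ?_
  rw [nsmul_eq_mul]
  exact mul_le_mul_of_nonneg_right (card_blockIndices_le hm hmn k) hV

theorem cubeBump_eq_zero_of_notMem_blockIndices {n m k : ℕ} {j : Fin n}
    (hj : j ∉ blockIndices n m k) (A : ℝ) {t : ℝ} (ht : t ∈ Icc ((j : ℝ) / n) ((j + 1) / n)) :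
    cubeBump A m k t = 0 := by
  have hn : (0 : ℝ) < n := Nat.cast_pos.2 j.pos
  have hlo := (div_le_iff₀ hn).1 ht.1
  have hhi := (le_div_iff₀ hn).1 ht.2
  refine cubeBump_eq_zero fun hmem ↦ hj (Finset.mem_filter.2 ⟨Finset.mem_univ j, ?_, ?_⟩)
  · calc (k : ℝ) * n < m * t * n := by gcongr; linarith [hmem.1]
      _ = m * (t * n) := mul_assoc _ _ _
      _ ≤ m * (j + 1) := by gcongr
  · calc (m : ℝ) * j ≤ m * (t * n) := by gcongr
      _ = m * t * n := (mul_assoc _ _ _).symm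
      _ < (k + 1) * n := by gcongr; linarith [hmem.2]

theorem sq_sqrt_sub_sqrt_le {c x y : ℝ} (hc : 0 < c) (hx : c ≤ x) (hy : c ≤ y) :
    (√x - √y) ^ 2 ≤ (x - y) ^ 2 / (4 * c) := by
  have hsum : 2 * √c ≤ √x + √y := by linarith [Real.sqrt_le_sqrt hx, Real.sqrt_le_sqrt hy]
  rw [le_div_iff₀ (by positivity)]
  calc (√x - √y) ^ 2 * (4 * c) = (√x - √y) ^ 2 * (2 * √c) ^ 2 := by
        rw [mul_pow, Real.sq_sqrt hc.le]; norm_num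
    _ ≤ (√x - √y) ^ 2 * (√x + √y) ^ 2 := by gcongr
    _ = (√x ^ 2 - √y ^ 2) ^ 2 := by ring
    _ = (x - y) ^ 2 := by rw [Real.sq_sqrt (hc.le.trans hx), Real.sq_sqrt (hc.le.trans hy)]

theorem div_natCeil_sqrt_le (n : ℕ) : (n : ℝ) / ⌈√(n : ℝ)⌉₊ ≤ √n := by
  refine div_le_of_le_mul₀ (Nat.cast_nonneg _) (Real.sqrt_nonneg _) ?_
  calc (n : ℝ) = √n * √n := (Real.mul_self_sqrt n.cast_nonneg).symm
    _ ≤ √n * ⌈√(n : ℝ)⌉₊ := by gcongr; exact Nat.le_ceil _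

theorem natCeil_sqrt_le {n : ℕ} (hn : 0 < n) : (⌈√(n : ℝ)⌉₊ : ℝ) ≤ 2 * √n := by
  have hone : 1 ≤ √(n : ℝ) := Real.one_le_sqrt.2 (Nat.one_le_cast.2 hn)
  linarith [Nat.ceil_lt_add_one (Real.sqrt_nonneg (n : ℝ))]

section BinIntegrals

variable {n m : ℕ} {l A : ℝ}

theorem integrableOn_bin_cubeFun (l A : ℝ) (θ : Fin m → Bool) (j : ℕ) :
    IntegrableOn (cubeFun l A θ) (bin n j) :=
  (contDiff_cubeFun l A θ 0).continuous.integrableOn_Ioc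

theorem le_setIntegral_bin_cubeFun (hA : 0 ≤ A) (θ : Fin m → Bool) (j : ℕ) :
    l / n ≤ ∫ x in bin n j, cubeFun l A θ x := by
  calc l / n = ∫ _ in bin n j, l := by
        rw [setIntegral_const, volume_real_bin, smul_eq_mul, one_div_mul_eq_div]
    _ ≤ ∫ x in bin n j, cubeFun l A θ x :=
        setIntegral_mono (integrableOn_const (by simp [volume_bin]))
          (integrableOn_bin_cubeFun l A θ j) (le_cubeFun hA θ)

theorem setIntegral_bin_cubeFun_update {θ : Fin m → Bool} {k : Fin m} (hk : θ k = false) (j : ℕ) :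
    ∫ x in bin n j, cubeFun l A (Function.update θ k true) x =
      (∫ x in bin n j, cubeFun l A θ x) + ∫ x in bin n j, cubeBump A m k x := by
  simp only [cubeFun_update hk]
  exact integral_add (integrableOn_bin_cubeFun l A θ j)
    (contDiff_cubeBump A m k 0).continuous.integrableOn_Ioc

theorem sq_setIntegral_bin_cubeBump_le (hA : 0 ≤ A) (k j : ℕ) :
    (∫ x in bin n j, cubeBump A m k x) ^ 2 ≤ (A / n) ^ 2 := by
  have hnorm := norm_setIntegral_le_of_norm_le_const (μ := volume) (s := bin n j)
    (f := cubeBump A m k) (by simp [volume_bin]) fun x _ ↦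
      (Real.norm_of_nonneg (cubeBump_nonneg hA m k x)).trans_le (cubeBump_le hA m k x)
  rw [volume_real_bin, mul_one_div] at hnorm
  exact sq_le_sq' (abs_le.1 hnorm).1 (abs_le.1 hnorm).2

theorem sum_sq_sqrt_setIntegral_bin_sub_le (hm : 0 < m) (hmn : m ≤ n) (hl : 0 < l) (hA : 0 ≤ A)
    {θ : Fin m → Bool} {k : Fin m} (hk : θ k = false) :
    ∑ j : Fin n, (√(∫ x in bin n j, cubeFun l A (Function.update θ k true) x) -
      √(∫ x in bin n j, cubeFun l A θ x)) ^ 2 ≤ A ^ 2 / m * (3 / (4 * l)) := by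
  have hn' : (0 : ℝ) < n := Nat.cast_pos.2 (hm.trans_le hmn)
  calc _ ≤ 3 * n / m * ((A / n) ^ 2 / (4 * (l / n))) := by
        refine sum_le_of_eq_zero_off_blockIndices hm hmn k (by positivity) (fun j hj ↦ ?_)
          fun j ↦ ?_
        · have hzero : ∫ x in bin n j, cubeBump A m k x = 0 :=
            setIntegral_eq_zero_of_forall_eq_zero fun x hx ↦
              cubeBump_eq_zero_of_notMem_blockIndices hj A ⟨hx.1.le, hx.2⟩
          rw [setIntegral_bin_cubeFun_update hk, hzero, add_zero, sub_self, zero_pow two_ne_zero]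
        · refine (sq_sqrt_sub_sqrt_le (by positivity : 0 < l / n)
            (le_setIntegral_bin_cubeFun hA _ j) (le_setIntegral_bin_cubeFun hA θ j)).trans ?_
          rw [setIntegral_bin_cubeFun_update hk, add_sub_cancel_left]
          gcongr ?_ / _
          exact sq_setIntegral_bin_cubeBump_le hA k j
    _ = A ^ 2 / m * (3 / (4 * l)) := by field_simp

theorem quarter_le_inf_obsLaw_sqrt_integral_univ (hm : 0 < m) (hmn : m ≤ n) (hl : 0 < l)
    (hA : 0 ≤ A) {τ : ℝ} (hτ : τ ≠ 0)
    (hle : A ^ 2 * √n / m * (3 / (4 * l) * (2 / l + 2 / τ ^ 2)) ≤ 1)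
    {θ : Fin m → Bool} {k : Fin m} (hk : θ k = false) :
    ENNReal.ofReal (1 / 4) ≤
      (obsLaw (fun _ : Fin n ↦ 1) (fun j ↦ √(∫ x in bin n j, cubeFun l A θ x)) τ ⊓
        obsLaw (fun _ : Fin n ↦ 1)
          (fun j ↦ √(∫ x in bin n j, cubeFun l A (Function.update θ k true) x)) τ) univ := by
  have hn : 0 < n := hm.trans_le hmn
  have hlower := le_setIntegral_bin_cubeFun (n := n) (l := l) hA θ
  set s : Fin n → ℝ := fun j ↦ √(∫ x in bin n j, cubeFun l A θ x)
  set s' : Fin n → ℝ := fun j ↦ √(∫ x in bin n j, cubeFun l A (Function.update θ k true) x)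
  have hS : ∑ j, (s' j - s j) ^ 2 ≤ A ^ 2 / m * (3 / (4 * l)) :=
    sum_sq_sqrt_setIntegral_bin_sub_le hm hmn hl hA hk
  refine quarter_le_inf_obsLaw_univ (K := ⌈√(n : ℝ)⌉₊) (Q := fun _ j ↦ s' j - s j) (v := l / n)
    (A := 1) (row := 0) (col := fun j ↦ (s' j - s j) ^ 2) (by positivity) hτ (fun _ j ↦ by ring)
    (by positivity) (fun p ↦ ?_) zero_le_one (fun _ ↦ (one_pow 2).le) (fun _ ↦ le_rfl)
    (fun j ↦ sq_nonneg _) (fun _ j ↦ (zero_add _).ge) ?_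
  · exact (hlower p).trans (Real.sq_sqrt ((by positivity : 0 ≤ l / n).trans (hlower p))).ge
  · simp only [sub_self, ne_eq, OfNat.ofNat_ne_zero, not_false_eq_true, zero_pow, Pi.zero_apply,
      Finset.sum_const_zero, add_zero, zero_add]
    set S := ∑ j, (s' j - s j) ^ 2
    calc 2 / (l / n) * (S / ⌈√(n : ℝ)⌉₊) + 1 / τ ^ 2 * (⌈√(n : ℝ)⌉₊ * S)
        = 2 / l * S * (n / ⌈√(n : ℝ)⌉₊) + 1 / τ ^ 2 * (⌈√(n : ℝ)⌉₊ * S) := by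
          rw [← div_mul]; ring
      _ ≤ 2 / l * S * √n + 1 / τ ^ 2 * (2 * √n * S) := by
          gcongr
          exacts [div_natCeil_sqrt_le n, natCeil_sqrt_le hn]
      _ = S * √n * (2 / l + 2 / τ ^ 2) := by ring
      _ ≤ A ^ 2 / m * (3 / (4 * l)) * √n * (2 / l + 2 / τ ^ 2) := by gcongr
      _ = A ^ 2 * √n / m * (3 / (4 * l) * (2 / l + 2 / τ ^ 2)) := by ring
      _ ≤ 1 := hle

end BinIntegrals

section CubeRatio

variable {n m k : ℕ} {l A : ℝ}

/-- The factor by which switching on the `k`-th bump multiplies the square root of a vertex of the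
hypercube. -/
def cubeRatio (l A : ℝ) (m k : ℕ) (x : ℝ) : ℝ := √(1 + cubeBump A m k x / l)

theorem sqrt_cubeFun_update (hl : 0 < l) (hA : 0 ≤ A) {θ : Fin m → Bool} {k : Fin m}
    (hk : θ k = false) (x : ℝ) :
    √(cubeFun l A (Function.update θ k true) x) = √(cubeFun l A θ x) * cubeRatio l A m k x := by
  rw [cubeFun_update hk, cubeRatio, ← Real.sqrt_mul (hl.le.trans (le_cubeFun hA θ x))]
  congr 1
  by_cases hx : (m : ℝ) * x - (k : ℕ) ∈ Ioo (0 : ℝ) 1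
  · rw [cubeFun_eq_of_mem hk hx, mul_add, mul_one, mul_div_cancel₀ _ hl.ne']
  · rw [cubeBump_eq_zero hx, zero_div, add_zero, add_zero, mul_one]

theorem cubeRatio_eq_one {x : ℝ} (hx : cubeBump A m k x = 0) : cubeRatio l A m k x = 1 := by
  rw [cubeRatio, hx, zero_div, add_zero, Real.sqrt_one]

theorem sq_cubeRatio_sub_le (hl : 0 < l) (hA : 0 ≤ A) (m k : ℕ) (x y : ℝ) :
    (cubeRatio l A m k x - cubeRatio l A m k y) ^ 2 ≤
      (cubeBump A m k x - cubeBump A m k y) ^ 2 / (4 * l ^ 2) := by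
  have hone_le : ∀ z, 1 ≤ 1 + cubeBump A m k z / l := fun z ↦
    le_add_of_nonneg_right (div_nonneg (cubeBump_nonneg hA m k z) hl.le)
  refine (sq_sqrt_sub_sqrt_le one_pos (hone_le x) (hone_le y)).trans_eq ?_
  field_simp
  ring

theorem sq_cubeRatio_sub_one_le (hl : 0 < l) (hA : 0 ≤ A) (m k : ℕ) (x : ℝ) :
    (cubeRatio l A m k x - 1) ^ 2 ≤ A ^ 2 / (4 * l ^ 2) := by
  have hone_le : 1 ≤ 1 + cubeBump A m k x / l :=
    le_add_of_nonneg_right (div_nonneg (cubeBump_nonneg hA m k x) hl.le)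
  have h := sq_sqrt_sub_sqrt_le one_pos hone_le le_rfl
  rw [Real.sqrt_one, add_sub_cancel_left] at h
  calc _ ≤ (cubeBump A m k x / l) ^ 2 / (4 * 1) := h
    _ = cubeBump A m k x ^ 2 / (4 * l ^ 2) := by field_simp
    _ ≤ A ^ 2 / (4 * l ^ 2) := by
        gcongr
        exacts [cubeBump_nonneg hA m k x, cubeBump_le hA m k x]

theorem cubeRatio_eq_one_of_notMem_blockIndices {j : Fin n} (hj : j ∉ blockIndices n m k)
    (l A : ℝ) {i : ℕ} (hi : (i : ℝ) = j ∨ (i : ℝ) = j + 1) : cubeRatio l A m k (i / n) = 1 := by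
  refine cubeRatio_eq_one (cubeBump_eq_zero_of_notMem_blockIndices hj A ?_)
  rcases hi with hi | hi <;> rw [hi]
  · exact ⟨le_rfl, by gcongr; linarith⟩
  · exact ⟨by gcongr; linarith, le_rfl⟩

theorem sum_sq_cubeRatio_sub_one_le (hm : 0 < m) (hmn : m ≤ n) (hl : 0 < l) (hA : 0 ≤ A) :
    ∑ i : Fin n, (cubeRatio l A m k ((i + 1 : ℕ) / n) - 1) ^ 2 * (1 / n) ≤
      A ^ 2 / m * (3 / (4 * l ^ 2)) := by
  have hn' : (0 : ℝ) < n := Nat.cast_pos.2 (hm.trans_le hmn)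
  calc _ ≤ 3 * n / m * (A ^ 2 / (4 * l ^ 2) * (1 / n)) := by
        refine sum_le_of_eq_zero_off_blockIndices hm hmn k (by positivity) (fun j hj ↦ ?_)
          fun j ↦ ?_
        · rw [cubeRatio_eq_one_of_notMem_blockIndices hj l A (.inr (Nat.cast_succ _)), sub_self,
            zero_pow two_ne_zero, zero_mul]
        · gcongr
          exact sq_cubeRatio_sub_one_le hl hA m k _
    _ = A ^ 2 / m * (3 / (4 * l ^ 2)) := by field_simp

theorem sum_sq_cubeRatio_sub_pred_le (hm : 0 < m) (hmn : m ≤ n) (hl : 0 < l) (hA : 0 ≤ A) {M : ℝ}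
    (hM : ∀ x y, |cubeBump A m k x - cubeBump A m k y| ≤ A * m * M * |x - y|) :
    ∑ p : Fin n, (cubeRatio l A m k ((p + 1 : ℕ) / n) -
      cubeRatio l A m k ((p - 1 + 1 : ℕ) / n)) ^ 2 ≤ A ^ 2 * m / n * (3 * M ^ 2 / (4 * l ^ 2)) := by
  have hn' : (0 : ℝ) < n := Nat.cast_pos.2 (hm.trans_le hmn)
  calc _ ≤ 3 * n / m * ((A * m * M * (1 / n)) ^ 2 / (4 * l ^ 2)) := by
        refine sum_le_of_eq_zero_off_blockIndices hm hmn k (by positivity) (fun j hj ↦ ?_)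
          fun j ↦ ?_
        all_goals rcases Nat.eq_zero_or_pos (j : ℕ) with hj_zero | hj_pos
        · simp [hj_zero]
        · rw [Nat.sub_add_cancel hj_pos, cubeRatio_eq_one_of_notMem_blockIndices hj l A (.inl rfl),
            cubeRatio_eq_one_of_notMem_blockIndices hj l A (.inr (Nat.cast_succ _)), sub_self,
            zero_pow two_ne_zero]
        · rw [hj_zero, zero_tsub, sub_self, zero_pow two_ne_zero]
          positivity
        · rw [Nat.sub_add_cancel hj_pos]
          refine (sq_cubeRatio_sub_le hl hA m k _ _).trans ?_
          have hstep : |cubeBump A m k ((j + 1 : ℕ) / n) - cubeBump A m k (j / n)| ≤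
              A * m * M * (1 / n) := by
            refine (hM _ _).trans_eq ?_
            rw [← sub_div, Nat.cast_succ, add_sub_cancel_left, abs_of_pos (one_div_pos.2 hn')]
          gcongr ?_ / _
          exact sq_le_sq' (abs_le.1 hstep).1 (abs_le.1 hstep).2
    _ = A ^ 2 * m / n * (3 * M ^ 2 / (4 * l ^ 2)) := by field_simp

theorem quarter_le_inf_obsLaw_sqrt_obsTime_univ (hm : 0 < m) (hmn : m ≤ n) (hl : 0 < l)
    (hA : 0 ≤ A) {τ u M : ℝ} (hτ : τ ≠ 0)
    (hM : ∀ (k : ℕ) x y, |cubeBump A m k x - cubeBump A m k y| ≤ A * m * M * |x - y|)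
    (hu : l + A ≤ u) (hle : A ^ 2 * √n / m * (3 / (4 * l ^ 2) * (2 + 2 * u / τ ^ 2)) +
      A ^ 2 * m * (3 * M ^ 2 / (2 * l ^ 2)) ≤ 1)
    {θ : Fin m → Bool} {k : Fin m} (hk : θ k = false) :
    ENNReal.ofReal (1 / 4) ≤
      (obsLaw (fun i : Fin n ↦ √(cubeFun l A θ (obsTime i))) (fun _ ↦ √(1 / n)) τ ⊓
        obsLaw (fun i : Fin n ↦ √(cubeFun l A (Function.update θ k true) (obsTime i)))
          (fun _ ↦ √(1 / n)) τ) univ := by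
  have hn : 0 < n := hm.trans_le hmn
  have hu_nonneg : 0 ≤ u := by linarith
  have hinv : √(1 / (n : ℝ)) ^ 2 = 1 / n := Real.sq_sqrt (by positivity)
  set ratio : ℕ → ℝ := fun i ↦ cubeRatio l A m k ((i + 1 : ℕ) / n)
  have hS := sum_sq_cubeRatio_sub_one_le (k := k) hm hmn hl hA
  have hdiff := sum_sq_cubeRatio_sub_pred_le hm hmn hl hA (hM k)
  refine quarter_le_inf_obsLaw_univ (K := ⌈√(n : ℝ)⌉₊)
    (Q := fun i _ ↦ (ratio i - 1) * √(1 / n)) (v := 1 / n) (A := u)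
    (row := fun i ↦ (ratio i - 1) ^ 2 * (1 / n)) (col := 0) (by positivity) hτ (fun i _ ↦ ?_)
    (by positivity) (fun _ ↦ hinv.ge) hu_nonneg (fun i ↦ ?_) (fun i ↦ by positivity)
    (fun _ ↦ le_rfl) (fun p j ↦ ?_) ?_
  · have htime : ((obsTime i : ℝ≥0) : ℝ) = (i + 1 : ℕ) / n := by simp [obsTime]
    rw [sqrt_cubeFun_update hl hA hk, htime]
    ring
  · rw [Real.sq_sqrt (hl.le.trans (le_cubeFun hA θ _))]
    exact (cubeFun_le hA θ _).trans hu
  · rw [mul_pow, hinv, Pi.zero_apply, add_zero]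
  · have hblock : ∑ p : Fin n, ∑ _j : Fin n,
        ((ratio p - 1) * √(1 / n) - (ratio (p - 1) - 1) * √(1 / n)) ^ 2 =
          ∑ p : Fin n, (ratio p - ratio (p - 1)) ^ 2 := by
      refine Finset.sum_congr rfl fun p _ ↦ ?_
      rw [← sub_mul, sub_sub_sub_cancel_right, mul_pow, hinv, Finset.sum_const, Finset.card_univ,
        Fintype.card_fin, nsmul_eq_mul]
      field_simp
    rw [hblock]
    simp only [Pi.zero_apply, Finset.sum_const_zero, add_zero]
    set S := ∑ i : Fin n, (ratio i - 1) ^ 2 * (1 / (n : ℝ))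
    calc _ ≤ 2 / (1 / (n : ℝ)) * (S / ⌈√(n : ℝ)⌉₊ + A ^ 2 * m / n * (3 * M ^ 2 / (4 * l ^ 2))) +
          u / τ ^ 2 * (⌈√(n : ℝ)⌉₊ * S) := by gcongr
      _ = 2 * S * (n / ⌈√(n : ℝ)⌉₊) + u / τ ^ 2 * (⌈√(n : ℝ)⌉₊ * S) +
          A ^ 2 * m * (3 * M ^ 2 / (2 * l ^ 2)) := by field_simp; ring
      _ ≤ 2 * S * √n + u / τ ^ 2 * (2 * √n * S) + A ^ 2 * m * (3 * M ^ 2 / (2 * l ^ 2)) := by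
          gcongr
          exacts [div_natCeil_sqrt_le n, natCeil_sqrt_le hn]
      _ = S * √n * (2 + 2 * u / τ ^ 2) + A ^ 2 * m * (3 * M ^ 2 / (2 * l ^ 2)) := by ring
      _ ≤ A ^ 2 / m * (3 / (4 * l ^ 2)) * √n * (2 + 2 * u / τ ^ 2) +
          A ^ 2 * m * (3 * M ^ 2 / (2 * l ^ 2)) := by gcongr
      _ = A ^ 2 * √n / m * (3 / (4 * l ^ 2) * (2 + 2 * u / τ ^ 2)) +
          A ^ 2 * m * (3 * M ^ 2 / (2 * l ^ 2)) := by ring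
      _ ≤ 1 := hle

end CubeRatio

/-! ### Assouad's lemma -/

section Assouad

/-- The squared loss restricted to the set `B`, the local loss of Assouad's lemma. -/
def sqLossOn (B : Set ℝ) (g f : ℝ → ℝ) : ℝ≥0∞ := ∫⁻ t in B, ENNReal.ofReal ((g t - f t) ^ 2)

theorem measurable_sqLossOn {X : Type*} [MeasurableSpace X] {T : X → ℝ → ℝ}
    (hT : Measurable (Function.uncurry T)) {f : ℝ → ℝ} (hf : Measurable f) (B : Set ℝ) :
    Measurable fun x ↦ sqLossOn B (T x) f :=
  ((hT.sub (hf.comp measurable_snd)).pow_const 2).ennreal_ofReal.lintegral_prod_right'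

theorem sum_sqLossOn_le_sqLossOn {ι : Type*} [Fintype ι] {B : ι → Set ℝ} {S : Set ℝ}
    (hB : ∀ i, MeasurableSet (B i)) (hB_disj : Pairwise (Function.onFun Disjoint B))
    (hBS : ∀ i, B i ⊆ S) (g f : ℝ → ℝ) : ∑ i, sqLossOn (B i) g f ≤ sqLossOn S g f := by
  simp only [sqLossOn]
  rw [← tsum_fintype (L := .unconditional _), ← lintegral_iUnion hB hB_disj]
  exact lintegral_mono_set (iUnion_subset hBS)

theorem sqLossOn_le_two_mul_add {g f : ℝ → ℝ} (hg : Measurable g) (hf : Measurable f)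
    (f' : ℝ → ℝ) (B : Set ℝ) :
    sqLossOn B f f' ≤ 2 * sqLossOn B g f + 2 * sqLossOn B g f' := by
  have hpoint : ∀ t, ENNReal.ofReal ((f t - f' t) ^ 2) ≤
      2 * (ENNReal.ofReal ((g t - f t) ^ 2) + ENNReal.ofReal ((g t - f' t) ^ 2)) := fun t ↦ by
    rw [← ENNReal.ofReal_add (sq_nonneg _) (sq_nonneg _), ← ENNReal.ofReal_ofNat 2,
      ← ENNReal.ofReal_mul zero_le_two]
    exact ENNReal.ofReal_le_ofReal (by nlinarith [sq_nonneg ((g t - f t) + (g t - f' t))])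
  refine (lintegral_mono hpoint).trans_eq ?_
  rw [lintegral_const_mul' _ _ ENNReal.ofNat_ne_top, lintegral_add_left (by fun_prop), mul_add]
  rfl

variable {ι : Type*} [Fintype ι] {Ω : Type*} [MeasurableSpace Ω] {P : Measure Ω} {n : ℕ}

theorem sum_lintegral_sqLossOn_le {Y : Ω → Fin n → ℝ} {ν : Measure (Fin n → ℝ)}
    (hY : HasLaw Y ν P) {T : (Fin n → ℝ) → ℝ → ℝ} (hT : Measurable (Function.uncurry T))
    {f : ℝ → ℝ} (hf : Measurable f) {B : ι → Set ℝ} (hB : ∀ i, MeasurableSet (B i))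
    (hB_disj : Pairwise (Function.onFun Disjoint B)) (hB_sub : ∀ i, B i ⊆ Icc 0 1) :
    ∑ i, ∫⁻ y, sqLossOn (B i) (T y) f ∂ν ≤ ∫⁻ ω, sqLoss (T (Y ω)) f ∂P := by
  rw [← lintegral_finsetSum _ fun i _ ↦ measurable_sqLossOn hT hf (B i)]
  refine (lintegral_mono fun y ↦ sum_sqLossOn_le_sqLossOn hB hB_disj hB_sub (T y) f).trans_eq ?_
  rw [← hY.lintegral_comp (measurable_sqLossOn hT hf _).aemeasurable]
  rfl

variable [DecidableEq ι]

theorem card_mul_le_two_mul_sum (k : ι) {a : (ι → Bool) → ℝ≥0∞} {D : ℝ≥0∞}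
    (h : ∀ θ, θ k = false → D ≤ a θ + a (Function.update θ k true)) :
    2 ^ Fintype.card ι * D ≤ 2 * ∑ θ, a θ := by
  set flipAt : (ι → Bool) → ι → Bool := fun θ ↦ Function.update θ k (!θ k) with hflip
  have hflip_inv : Function.Involutive flipAt := fun θ ↦ by simp [hflip]
  have hpair : ∀ θ, D ≤ a θ + a (flipAt θ) := fun θ ↦ by
    cases hθ : θ k with
    | false => simpa [hflip, hθ] using h θ hθ
    | true =>
      have hpair_flip := h (flipAt θ) (by simp [hflip, hθ])
      rwa [hflip, Function.update_idem, ← hθ, Function.update_eq_self, add_comm] at hpair_flip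
  calc 2 ^ Fintype.card ι * D = ∑ _θ : ι → Bool, D := by simp
    _ ≤ ∑ θ, (a θ + a (flipAt θ)) := Finset.sum_le_sum fun θ _ ↦ hpair θ
    _ = 2 * ∑ θ, a θ := by
        rw [Finset.sum_add_distrib, two_mul]
        exact congrArg _ (Equiv.sum_comp hflip_inv.toPerm a)

theorem card_mul_le_two_mul_of_sum_le {a : ι → (ι → Bool) → ℝ≥0∞} {D R : ℝ≥0∞}
    (hD : ∀ k θ, θ k = false → D ≤ a k θ + a k (Function.update θ k true))
    (hR : ∀ θ, ∑ k, a k θ ≤ R) : Fintype.card ι * D ≤ 2 * R := by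
  have hcube : 2 ^ Fintype.card ι * (Fintype.card ι * D) ≤ 2 ^ Fintype.card ι * (2 * R) := calc
    _ = ∑ _k : ι, 2 ^ Fintype.card ι * D := by
        rw [Finset.sum_const, Finset.card_univ, nsmul_eq_mul, mul_left_comm]
    _ ≤ ∑ k, 2 * ∑ θ, a k θ := Finset.sum_le_sum fun k _ ↦ card_mul_le_two_mul_sum k (hD k)
    _ = 2 * ∑ θ, ∑ k, a k θ := by rw [← Finset.mul_sum, Finset.sum_comm]
    _ ≤ 2 * ∑ _θ : ι → Bool, R := by gcongr with θ; exact hR θ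
    _ = 2 ^ Fintype.card ι * (2 * R) := by simp [mul_left_comm]
  exact (ENNReal.mul_le_mul_iff_right (by simp) (by simp)).1 hcube

theorem assouad_minimaxRisk {F : Set (ℝ → ℝ)} {Y : (ℝ → ℝ) → Ω → Fin n → ℝ}
    {f : (ι → Bool) → ℝ → ℝ} (hf_mem : ∀ θ, f θ ∈ F) (hf : ∀ θ, Measurable (f θ))
    {ν : (ι → Bool) → Measure (Fin n → ℝ)} (hY : ∀ θ, HasLaw (Y (f θ)) (ν θ) P)
    {B : ι → Set ℝ} (hB : ∀ i, MeasurableSet (B i))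
    (hB_disj : Pairwise (Function.onFun Disjoint B)) (hB_sub : ∀ i, B i ⊆ Icc 0 1)
    {D κ : ℝ≥0∞}
    (hD : ∀ θ k, θ k = false → D ≤ sqLossOn (B k) (f θ) (f (Function.update θ k true)))
    (hκ : ∀ θ k, θ k = false → κ ≤ (ν θ ⊓ ν (Function.update θ k true)) univ) (r : ℝ) :
    ENNReal.ofReal r * (Fintype.card ι * (D * κ)) ≤ 4 * minimaxRisk P r F Y := by
  suffices hT : ∀ T : (Fin n → ℝ) → ℝ → ℝ, Measurable (Function.uncurry T) →
      ENNReal.ofReal r * (Fintype.card ι * (D * κ)) / 4 ≤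
        ⨆ f ∈ F, ∫⁻ ω, ENNReal.ofReal r * sqLoss (T (Y f ω)) f ∂P from
    (ENNReal.div_le_iff' (by simp) (by simp)).1 (le_iInf₂ hT)
  intro T hT
  set R := ⨆ f ∈ F, ∫⁻ ω, ENNReal.ofReal r * sqLoss (T (Y f ω)) f ∂P
  set J : ι → (ι → Bool) → ℝ≥0∞ := fun k θ ↦ ∫⁻ y, sqLossOn (B k) (T y) (f θ) ∂ν θ
  have hvertex : ∀ θ, ENNReal.ofReal r * ∑ k, J k θ ≤ R := fun θ ↦ calc
    _ ≤ ENNReal.ofReal r * ∫⁻ ω, sqLoss (T (Y (f θ) ω)) (f θ) ∂P := by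
        gcongr; exact sum_lintegral_sqLossOn_le (hY θ) hT (hf θ) hB hB_disj hB_sub
    _ = ∫⁻ ω, ENNReal.ofReal r * sqLoss (T (Y (f θ) ω)) (f θ) ∂P :=
        (lintegral_const_mul' _ _ ENNReal.ofReal_ne_top).symm
    _ ≤ R := le_iSup₂ (f := fun f (_ : f ∈ F) ↦
        ∫⁻ ω, ENNReal.ofReal r * sqLoss (T (Y f ω)) f ∂P) _ (hf_mem θ)
  have hedge : ∀ k θ, θ k = false → D * κ ≤ 2 * J k θ + 2 * J k (Function.update θ k true) := by
    intro k θ hθ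
    have hloss : ∀ θ, Measurable fun y ↦ sqLossOn (B k) (T y) (f θ) := fun θ ↦
      measurable_sqLossOn hT (hf θ) (B k)
    have hsep : ∀ y, D ≤ 2 * sqLossOn (B k) (T y) (f θ) +
        2 * sqLossOn (B k) (T y) (f (Function.update θ k true)) := fun y ↦
      (hD θ k hθ).trans (sqLossOn_le_two_mul_add hT.of_uncurry_left (hf θ) _ _)
    refine (mul_le_mul_right (hκ θ k hθ) D).trans
      ((mul_inf_univ_le_lintegral_add ((hloss θ).const_mul 2) hsep).trans_eq ?_)
    rw [lintegral_const_mul _ (hloss _), lintegral_const_mul _ (hloss _)]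
  have hcube : Fintype.card ι * (ENNReal.ofReal r * (D * κ)) ≤ 2 * (2 * R) := by
    refine card_mul_le_two_mul_of_sum_le (a := fun k θ ↦ ENNReal.ofReal r * (2 * J k θ))
      (fun k θ hθ ↦ ?_) fun θ ↦ ?_
    · rw [← mul_add]
      gcongr
      exact hedge k θ hθ
    · simp only [mul_left_comm _ (2 : ℝ≥0∞), ← Finset.mul_sum]
      gcongr
      exact hvertex θ
  rw [ENNReal.div_le_iff' (by simp) (by simp), mul_left_comm]
  exact hcube.trans_eq (by ring)

end Assouad

theorem le_minimaxRisk_of_cubeFun_mem {Ω : Type*} [MeasurableSpace Ω] {P : Measure Ω} {n m : ℕ}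
    (hm : 0 < m) {l A r : ℝ} (hr : 0 ≤ r) {F : Set (ℝ → ℝ)}
    (hF : ∀ θ : Fin m → Bool, cubeFun l A θ ∈ F) {Y : (ℝ → ℝ) → Ω → Fin n → ℝ}
    {ν : (Fin m → Bool) → Measure (Fin n → ℝ)} (hY : ∀ θ, HasLaw (Y (cubeFun l A θ)) (ν θ) P)
    (hν : ∀ θ k, θ k = false →
      ENNReal.ofReal (1 / 4) ≤ (ν θ ⊓ ν (Function.update θ k true)) univ) :
    ENNReal.ofReal (r * A ^ 2 / 32) ≤ minimaxRisk P r F Y := by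
  have hsep : ∀ (θ : Fin m → Bool) k, θ k = false → ENNReal.ofReal (A ^ 2 / (2 * m)) ≤
      sqLossOn (bin m k) (cubeFun l A θ) (cubeFun l A (Function.update θ k true)) := by
    intro θ k hk
    simp only [sqLossOn, cubeFun_update hk, sub_add_cancel_left, neg_sq]
    exact ofReal_le_lintegral_cubeBump_sq hm A k
  have hassouad := assouad_minimaxRisk hF
    (fun θ ↦ (contDiff_cubeFun l A θ 0).continuous.measurable) hY
    (fun k : Fin m ↦ measurableSet_bin m k)
    ((pairwise_disjoint_bin m).comp_of_injective Fin.val_injective) bin_subset_Icc hsep hν r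
  have hconst : ENNReal.ofReal r * (Fintype.card (Fin m) *
      (ENNReal.ofReal (A ^ 2 / (2 * m)) * ENNReal.ofReal (1 / 4))) =
        4 * ENNReal.ofReal (r * A ^ 2 / 32) := by
    rw [Fintype.card_fin, ← ENNReal.ofReal_natCast, ← ENNReal.ofReal_mul (by positivity),
      ← ENNReal.ofReal_mul (by positivity), ← ENNReal.ofReal_mul hr, ← ENNReal.ofReal_ofNat 4,
      ← ENNReal.ofReal_mul (by positivity)]
    congr 1
    field_simp
    ring
  rw [hconst] at hassouad
  exact (ENNReal.mul_le_mul_iff_right (by simp) (by simp)).1 hassouad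

/-! ### The lower bounds -/

section Bandwidth

variable {α : ℝ} {n : ℕ}

/-- The number of bumps. Bumps of height `A ∼ m ^ (-α)` stay in the Hölder class, and switching one
of them is not detectable from `n` observations as long as `A ^ 2 * √n / m` is bounded, that is,
`n ≲ m ^ (4 * α + 2)`. -/
def bandwidth (α : ℝ) (n : ℕ) : ℕ := ⌈(n : ℝ) ^ (1 / (4 * α + 2))⌉₊

theorem bandwidth_pos (α : ℝ) (hn : 0 < n) : 0 < bandwidth α n :=
  Nat.ceil_pos.2 (Real.rpow_pos_of_pos (Nat.cast_pos.2 hn) _)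

theorem bandwidth_le (hα : 0 ≤ α) (hn : 0 < n) : bandwidth α n ≤ n := by
  refine Nat.ceil_le.2 ((Real.rpow_le_rpow_of_exponent_le (Nat.one_le_cast.2 hn) ?_).trans_eq
    (Real.rpow_one _))
  rw [div_le_one (by linarith)]
  linarith

theorem sq_rpow_neg {x : ℝ} (hx : 0 ≤ x) (α : ℝ) : (x ^ (-α)) ^ 2 = x ^ (-(2 * α)) := by
  rw [← Real.rpow_mul_natCast hx]
  congr 1
  push_cast
  ring

theorem sq_bandwidth_rpow_mul_sqrt_div_le_one (hα : 0 ≤ α) (hn : 0 < n) :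
    ((bandwidth α n : ℝ) ^ (-α)) ^ 2 * √n / bandwidth α n ≤ 1 := by
  set x : ℝ := (n : ℝ) ^ (1 / (4 * α + 2)) with hx
  have hm : (0 : ℝ) < bandwidth α n := Nat.cast_pos.2 (bandwidth_pos α hn)
  have hsqrt : √(n : ℝ) = x ^ (2 * α + 1) := by
    rw [hx, ← Real.rpow_mul n.cast_nonneg, Real.sqrt_eq_rpow]
    congr 1
    field_simp
    ring
  rw [div_le_one hm, sq_rpow_neg hm.le, hsqrt]
  calc (bandwidth α n : ℝ) ^ (-(2 * α)) * x ^ (2 * α + 1)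
      ≤ (bandwidth α n : ℝ) ^ (-(2 * α)) * (bandwidth α n : ℝ) ^ (2 * α + 1) := by
        gcongr; exact Nat.le_ceil x
    _ = bandwidth α n := by rw [← Real.rpow_add hm, neg_add_cancel_left, Real.rpow_one]

theorem two_rpow_le_rpow_mul_sq_bandwidth_rpow (hα : 0 ≤ α) (hn : 0 < n) :
    (2 : ℝ) ^ (-(2 * α)) ≤
      (n : ℝ) ^ (α / (2 * α + 1)) * ((bandwidth α n : ℝ) ^ (-α)) ^ 2 := by
  set x : ℝ := (n : ℝ) ^ (1 / (4 * α + 2)) with hx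
  have hx_pos : 0 < x := Real.rpow_pos_of_pos (Nat.cast_pos.2 hn) _
  have hx_one : 1 ≤ x := Real.one_le_rpow (Nat.one_le_cast.2 hn) (by positivity)
  have hm : (0 : ℝ) < bandwidth α n := Nat.cast_pos.2 (bandwidth_pos α hn)
  have hm_le : (bandwidth α n : ℝ) ≤ 2 * x :=
    (Nat.ceil_lt_add_one hx_pos.le).le.trans (by linarith)
  have hrate : (n : ℝ) ^ (α / (2 * α + 1)) = x ^ (2 * α) := by
    rw [hx, ← Real.rpow_mul n.cast_nonneg]
    congr 1
    field_simp
    ring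
  rw [sq_rpow_neg hm.le, hrate]
  calc (2 : ℝ) ^ (-(2 * α)) = x ^ (2 * α) * (2 * x) ^ (-(2 * α)) := by
        rw [Real.mul_rpow zero_le_two hx_pos.le, mul_left_comm, ← Real.rpow_add hx_pos,
          add_neg_cancel, Real.rpow_zero, mul_one]
    _ ≤ x ^ (2 * α) * (bandwidth α n : ℝ) ^ (-(2 * α)) :=
        mul_le_mul_of_nonneg_left (Real.rpow_le_rpow_of_nonpos hm hm_le (by linarith))
          (by positivity)

theorem sq_rpow_neg_mul_le_one (hα : 1 / 2 ≤ α) {x : ℝ} (hx : 1 ≤ x) :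
    (x ^ (-α)) ^ 2 * x ≤ 1 := by
  have hx_pos : 0 < x := one_pos.trans_le hx
  rw [sq_rpow_neg hx_pos.le, ← Real.rpow_add_one hx_pos.ne']
  exact Real.rpow_le_one_of_one_le_of_nonpos hx (by linarith)

theorem exists_pos_le_sq_mul_le_one {c₀ : ℝ} (hc₀ : 0 < c₀) (B : ℝ) :
    ∃ c > 0, c ≤ c₀ ∧ c ^ 2 * B ≤ 1 := by
  have hlim : Tendsto (fun c : ℝ ↦ c ^ 2 * B) (𝓝[>] 0) (𝓝 0) :=
    (Continuous.tendsto' (by fun_prop) 0 0 (by simp)).mono_left nhdsWithin_le_nhds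
  have hIoc : ∀ᶠ c in 𝓝[>] 0, c ∈ Ioc 0 c₀ := Ioc_mem_nhdsGT hc₀
  obtain ⟨c, hc, hcB⟩ := (hIoc.and (hlim.eventually_le_const one_pos)).exists
  exact ⟨c, hc.1, hc.2, hcB⟩

end Bandwidth

section LowerBound

variable {α L l u τ : ℝ}

theorem exists_pos_cubeFun_bandwidth_mem_boundedHolder (hα : 0 ≤ α) (hL : 0 < L) (hlu : l < u)
    (B : ℝ) : ∃ c > 0, c ≤ u - l ∧ c ^ 2 * B ≤ 1 ∧ ∀ {n : ℕ}, 0 < n →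
      ∀ θ : Fin (bandwidth α n) → Bool,
        cubeFun l (c * (bandwidth α n : ℝ) ^ (-α)) θ ∈ boundedHolder α L l u := by
  obtain ⟨c₀, hc₀, hmem⟩ := exists_cubeFun_mem_boundedHolder hα hL hlu
  obtain ⟨c, hc, hc_le, hcB⟩ := exists_pos_le_sq_mul_le_one (lt_min hc₀ (sub_pos.2 hlu)) B
  refine ⟨c, hc, hc_le.trans (min_le_right _ _), hcB, fun {n} hn ↦ ?_⟩
  have hm : (0 : ℝ) < bandwidth α n := Nat.cast_pos.2 (bandwidth_pos α hn)
  refine hmem (bandwidth_pos α hn) (by positivity) ?_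
  rw [mul_assoc, ← Real.rpow_add hm, neg_add_cancel, Real.rpow_zero, mul_one]
  exact hc_le.trans (min_le_left _ _)

theorem le_minimaxRisk_of_cubeFun_bandwidth_mem (hα : 0 ≤ α) {n : ℕ} (hn : 0 < n) {c : ℝ}
    {F : Set (ℝ → ℝ)}
    (hF : ∀ θ : Fin (bandwidth α n) → Bool, cubeFun l (c * (bandwidth α n : ℝ) ^ (-α)) θ ∈ F)
    {Ω : Type*} [MeasurableSpace Ω] {P : Measure Ω} {Y : (ℝ → ℝ) → Ω → Fin n → ℝ}
    {ν : (Fin (bandwidth α n) → Bool) → Measure (Fin n → ℝ)}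
    (hY : ∀ θ, HasLaw (Y (cubeFun l (c * (bandwidth α n : ℝ) ^ (-α)) θ)) (ν θ) P)
    (hν : ∀ θ k, θ k = false →
      ENNReal.ofReal (1 / 4) ≤ (ν θ ⊓ ν (Function.update θ k true)) univ) :
    ENNReal.ofReal (c ^ 2 * 2 ^ (-(2 * α)) / 32) ≤
      minimaxRisk P ((n : ℝ) ^ (α / (2 * α + 1))) F Y := by
  refine (ENNReal.ofReal_le_ofReal ?_).trans
    (le_minimaxRisk_of_cubeFun_mem (bandwidth_pos α hn) (by positivity) hF hY hν)
  rw [mul_pow, mul_left_comm]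
  gcongr
  exact two_rpow_le_rpow_mul_sq_bandwidth_rpow hα hn

theorem exists_le_minimaxRisk_obsIntegral (hα : 0 ≤ α) (hL : 0 < L) (hl : 0 < l) (hlu : l < u)
    (hτ : τ ≠ 0) :
    ∃ C : ℝ, 0 < C ∧ ∀ {Ω : Type*} [MeasurableSpace Ω] {P : Measure Ω} {W : ℝ≥0 → Ω → ℝ},
      IsPreBrownianReal W P → ∀ {n : ℕ}, 0 < n → ∀ {ε : Fin n → Ω → ℝ},
        (∀ i, HasLaw (ε i) (gaussianReal 0 1) P) → iIndepFun ε P →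
        IndepFun (fun ω t ↦ W t ω) (fun ω i ↦ ε i ω) P →
        ENNReal.ofReal C ≤ minimaxRisk P ((n : ℝ) ^ (α / (2 * α + 1))) (boundedHolder α L l u)
          (obsIntegral P W τ ε) := by
  set B := 3 / (4 * l) * (2 / l + 2 / τ ^ 2)
  obtain ⟨c, hc, -, hcB, hmem⟩ :=
    exists_pos_cubeFun_bandwidth_mem_boundedHolder (l := l) hα hL hlu B
  refine ⟨c ^ 2 * 2 ^ (-(2 * α)) / 32, by positivity, ?_⟩
  intro Ω _ P W hW n hn ε hε hindep hWε
  have hm := bandwidth_pos α hn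
  set A := c * (bandwidth α n : ℝ) ^ (-α) with hA
  have hA_nonneg : 0 ≤ A := by positivity
  refine le_minimaxRisk_of_cubeFun_bandwidth_mem hα hn (hmem hn) (fun θ ↦
    hasLaw_obsIntegral hW (contDiff_cubeFun l A θ 0).continuous.continuousOn
      (fun x _ ↦ hl.le.trans (le_cubeFun hA_nonneg θ x))
      (fun j ↦ (by positivity : 0 < l / n).trans_le (le_setIntegral_bin_cubeFun hA_nonneg θ j))
      hε hindep hWε τ)
    fun θ k hk ↦ quarter_le_inf_obsLaw_sqrt_integral_univ hm (bandwidth_le hα hn) hl hA_nonneg hτ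
      ?_ hk
  calc A ^ 2 * √n / bandwidth α n * B
      = c ^ 2 * B * (((bandwidth α n : ℝ) ^ (-α)) ^ 2 * √n / bandwidth α n) := by rw [hA]; ring
    _ ≤ c ^ 2 * B := mul_le_of_le_one_right (by positivity)
        (sq_bandwidth_rpow_mul_sqrt_div_le_one hα hn)
    _ ≤ 1 := hcB

theorem exists_le_minimaxRisk_obsProduct (hα : 1 / 2 ≤ α) (hL : 0 < L) (hl : 0 < l) (hlu : l < u)
    (hτ : τ ≠ 0) :
    ∃ C : ℝ, 0 < C ∧ ∀ {Ω : Type*} [MeasurableSpace Ω] {P : Measure Ω} {W : ℝ≥0 → Ω → ℝ},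
      IsPreBrownianReal W P → ∀ {n : ℕ}, 0 < n → ∀ {ε : Fin n → Ω → ℝ},
        (∀ i, HasLaw (ε i) (gaussianReal 0 1) P) → iIndepFun ε P →
        IndepFun (fun ω t ↦ W t ω) (fun ω i ↦ ε i ω) P →
        ENNReal.ofReal C ≤ minimaxRisk P ((n : ℝ) ^ (α / (2 * α + 1))) (boundedHolder α L l u)
          (obsProduct W τ ε) := by
  have hα_nonneg : 0 ≤ α := by linarith
  have hu : 0 < u := hl.trans hlu
  obtain ⟨M, hM⟩ := exists_lipschitz_cubeBump
  set B₁ := 3 / (4 * l ^ 2) * (2 + 2 * u / τ ^ 2)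
  set B₂ := 3 * M ^ 2 / (2 * l ^ 2)
  obtain ⟨c, hc, hc_le, hcB, hmem⟩ :=
    exists_pos_cubeFun_bandwidth_mem_boundedHolder hα_nonneg hL hlu (B₁ + B₂)
  refine ⟨c ^ 2 * 2 ^ (-(2 * α)) / 32, by positivity, ?_⟩
  intro Ω _ P W hW n hn ε hε hindep hWε
  have hm := bandwidth_pos α hn
  have hm_one : (1 : ℝ) ≤ bandwidth α n := Nat.one_le_cast.2 hm
  set A := c * (bandwidth α n : ℝ) ^ (-α) with hA
  have hA_nonneg : 0 ≤ A := by positivity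
  have hA_le : l + A ≤ u := by
    linarith [mul_le_of_le_one_right hc.le
      (Real.rpow_le_one_of_one_le_of_nonpos hm_one (neg_nonpos.2 hα_nonneg))]
  refine le_minimaxRisk_of_cubeFun_bandwidth_mem hα_nonneg hn (hmem hn)
    (fun θ ↦ hasLaw_obsProduct hW (cubeFun l A θ) hε hindep hWε τ) fun θ k hk ↦
      quarter_le_inf_obsLaw_sqrt_obsTime_univ hm (bandwidth_le hα_nonneg hn) hl hA_nonneg hτ
        (hM A hA_nonneg _) hA_le ?_ hk
  calc A ^ 2 * √n / bandwidth α n * B₁ + A ^ 2 * bandwidth α n * B₂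
      = c ^ 2 * (B₁ * (((bandwidth α n : ℝ) ^ (-α)) ^ 2 * √n / bandwidth α n) +
          B₂ * (((bandwidth α n : ℝ) ^ (-α)) ^ 2 * bandwidth α n)) := by rw [hA]; ring
    _ ≤ c ^ 2 * (B₁ * 1 + B₂ * 1) := by
        gcongr
        exacts [sq_bandwidth_rpow_mul_sqrt_div_le_one hα_nonneg hn,
          sq_rpow_neg_mul_le_one hα hm_one]
    _ = c ^ 2 * (B₁ + B₂) := by rw [mul_one, mul_one]
    _ ≤ 1 := hcB

end LowerBound

end

end VolatilityModel

theorem mainTheorem2_general {α L l u τ : ℝ} (hL : 0 < L) (hl : 0 < l) (hlu : l < u)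
    (hτ : τ ≠ 0) :
    ∃ C : ℝ, 0 < C ∧
      ∀ {Ω : Type*} [MeasurableSpace Ω] {P : Measure Ω} {W : ℝ≥0 → Ω → ℝ},
        IsPreBrownianReal W P → ∀ {n : ℕ}, 0 < n → ∀ {ε : Fin n → Ω → ℝ},
        (∀ i, HasLaw (ε i) (gaussianReal 0 1) P) → iIndepFun ε P →
        IndepFun (fun ω t ↦ W t ω) (fun ω i ↦ ε i ω) P →
        (0 ≤ α → ENNReal.ofReal C ≤
          VolatilityModel.minimaxRisk P ((n : ℝ) ^ (α / (2 * α + 1)))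
            (VolatilityModel.boundedHolder α L l u) (VolatilityModel.obsIntegral P W τ ε)) ∧
        (1 / 2 ≤ α → ENNReal.ofReal C ≤
          VolatilityModel.minimaxRisk P ((n : ℝ) ^ (α / (2 * α + 1)))
            (VolatilityModel.boundedHolder α L l u) (VolatilityModel.obsProduct W τ ε)) := by
  rcases lt_or_ge α 0 with hα | hα
  · refine ⟨1, one_pos, ?_⟩
    intros
    exact ⟨fun h ↦ absurd h hα.not_ge, fun h ↦ absurd h (by linarith)⟩
  obtain ⟨C₁, hC₁, hintegral⟩ :=
    VolatilityModel.exists_le_minimaxRisk_obsIntegral hα hL hl hlu hτ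
  rcases lt_or_ge α (1 / 2) with hα_half | hα_half
  · exact ⟨C₁, hC₁, fun hW _ hn _ hε hindep hWε ↦
      ⟨fun _ ↦ hintegral hW hn hε hindep hWε, fun h ↦ absurd h hα_half.not_ge⟩⟩
  obtain ⟨C₂, hC₂, hproduct⟩ :=
    VolatilityModel.exists_le_minimaxRisk_obsProduct hα_half hL hl hlu hτ
  exact ⟨min C₁ C₂, lt_min hC₁ hC₂, fun hW _ hn _ hε hindep hWε ↦
    ⟨fun _ ↦ (ENNReal.ofReal_le_ofReal (min_le_left _ _)).trans
        (hintegral hW hn hε hindep hWε),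
      fun _ ↦ (ENNReal.ofReal_le_ofReal (min_le_right _ _)).trans
        (hproduct hW hn hε hindep hWε)⟩⟩

theorem mainTheorem2 (α L l u τ : ℝ) (hL : 0 < L) (hl : 0 < l) (hlu : l < u) (hτ : 0 < τ) :
    ∃ C : ℝ, 0 < C ∧
      ∀ {Ω : Type*} [MeasurableSpace Ω] (P : Measure Ω) [IsProbabilityMeasure P]
        (W : ℝ≥0 → Ω → ℝ) (ε : (n : ℕ) → Fin n → Ω → ℝ),
        IsBrownianReal W P →
        (∀ n i, HasLaw (ε n i) (gaussianReal 0 1) P) →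
        (∀ n, iIndepFun (ε n) P) →
        (∀ n, IndepFun (fun ω t ↦ W t ω) (fun ω i ↦ ε n i ω) P) →
        (1 / 2 < α →
          ENNReal.ofReal C ≤ liminf (fun n : ℕ ↦
            VolatilityModel.minimaxRisk P ((n : ℝ) ^ (α / (2 * α + 1)))
              (VolatilityModel.boundedHolder α L l u)
              (VolatilityModel.obsIntegral P W τ (ε n))) atTop) ∧
        (1 ≤ α →
          ENNReal.ofReal C ≤ liminf (fun n : ℕ ↦
            VolatilityModel.minimaxRisk P ((n : ℝ) ^ (α / (2 * α + 1)))
              (VolatilityModel.boundedHolder α L l u)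
              (VolatilityModel.obsProduct W τ (ε n))) atTop) := by
  obtain ⟨C, hC, hrisk⟩ := mainTheorem2_general (α := α) hL hl hlu hτ.ne'
  refine ⟨C, hC, fun P _ W ε hW hε hindep hWε ↦ ?_⟩
  have hrisk_n {n : ℕ} (hn : 0 < n) :=
    hrisk hW.toIsPreBrownianReal hn (hε n) (hindep n) (hWε n)
  constructor <;> intro hα <;> refine le_liminf_of_le (by isBoundedDefault) ?_ <;>
    filter_upwards [eventually_gt_atTop 0] with n hn
  · exact (hrisk_n hn).1 (by linarith)
  · exact (hrisk_n hn).2 (by linarith)
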